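/- Let $S$ be a finite set and, for each $\lambda>0$, let $Q(\lambda)=(q_{ij}(\lambda))_{i,j\in S}$ be an irreducible transition rate matrix on $S$. Put $q_i(\lambda)=-q_{ii}(\lambda)$, and let $\Omega(\lambda)=(\omega_{ij}(\lambda))$ be the transition matrix of the jump chain, $\omega_{ij}(\lambda)=q_{ij}(\lambda)/q_i(\lambda)$ for $i\ne j$ and $\omega_{ii}(\lambda)=0$. Assume that for all $i\neq j$ the limit $\lim_{\lambda\to\infty}q_{ij}(\lambda)$ exists in $[0,\infty]$ and the limit $\lim_{\lambda\to\infty}\omega_{ij}(\lambda)$ exists; write $Q=\lim_{\lambda\to\infty} Q(\lambda)$ (entries may be infinite), $q_i=\lim_{\lambda\to\infty} q_i(\lambda)$ and $\Omega=\lim_{\lambda\to\infty}\Omega(\lambda)$. Let $A=\{i\in S: q_i=\infty\}$ be the set of fast states and $B=\{i\in S:q_i<\infty\}$ the set of slow states, and use these sets as indices for blocks of matrices and vectors. Assume that $B\neq\emptyset$, that $q_i>0$ for every $i\in B$, and that the discrete-time Markov chain $\eta$ with transition matrix $\Omega$, started from any $i\in A$, reaches $B$ in finite time almost surely. Let $X$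 be the continuous-time Markov chain on $S$ with rate matrix $Q(\lambda)$, and let the reduced chain $Y$ be the continuous-time Markov chain on $B$ with rate matrix $$\Gamma=Q_{BB}+Q_{BA}(I-\Omega_{AA})^{-1}\Omega_{AB}.$$ For a probability distribution $\pi=(\pi_A,\pi_B)$ on $S$ put $\gamma(\pi)=\pi_B+\pi_A(I-\Omega_{AA})^{-1}\Omega_{AB}$, a probability distribution on $B$. Write $P^\lambda_\pi$ for the law of $X$ under rate matrix $Q(\lambda)$ and initial distribution $\pi$, $P_{\gamma(\pi)}$ for the law of $Y$ with initial distribution $\gamma(\pi)$, and $d_{TV}(\mu,\nu)=\frac12\sum_{i\in S}|\mu_i-\nu_i|$ for probability distributions $\mu,\nu$ on $S$ (a distribution on $B$ being extended to $S$ by zero). Assume that the reduced chain $Y$ is irreducible. Then for every probability distribution $\pi$ on $S$ and every $h>0$, $$\lim_{\lambda\to\infty}\ \sup_{t\ge h}\ d_{TV}\bigl(P^\lambda_\pi(X_t\in\cdot),\,P_{\gamma(\pi)}(Y_t\in\cdot)\bigr)=0.$$ -/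

import Mathlib

open Filter Topology MeasureTheory
open scoped NNReal ENNReal Matrix

noncomputable section

namespace TwoTimeScale

/-- `Q` is a transition rate matrix: nonnegative off-diagonal entries, rows summing to zero. -/
structure IsRateMatrix {E : Type*} [Fintype E] (Q : Matrix E E ℝ) : Prop where
  nonneg : ∀ i j, i ≠ j → 0 ≤ Q i j
  row_sum : ∀ i, ∑ j, Q i j = 0

/-- Irreducibility of a rate matrix: from every state one can reach every other state through
finitely many transitions of positive rate. -/
def IsIrreducibleRate {E : Type*} (Q : Matrix E E ℝ) : Prop :=
  ∀ i j, Relation.ReflTransGen (fun a b => a ≠ b ∧ 0 < Q a b) i j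

/-- The rate `q_i = -q_{ii}` of the holding time of state `i`. -/
def exitRate {E : Type*} (Q : Matrix E E ℝ) (i : E) : ℝ := - Q i i

/-- The transition probability matrix of the jump chain:
`ω_{ij} = q_{ij} / q_i` for `i ≠ j` and `ω_{ii} = 0`. -/
def jumpMatrix {E : Type*} [DecidableEq E] (Q : Matrix E E ℝ) : Matrix E E ℝ :=
  Matrix.of fun i j => if i = j then 0 else Q i j / exitRate Q i

/-- `X` is, under `P`, a continuous-time Markov chain on the finite set `E` with transition rate
matrix `Q` (hence transition semigroup `exp (t Q)`) and initial distribution `π`: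
right-continuous paths (`E` being discrete) and the Markovian finite-dimensional distributions. -/
structure IsMarkovChain {E : Type*} [Fintype E] [DecidableEq E] (Q : Matrix E E ℝ) (π : E → ℝ)
    {Ω : Type*} [MeasurableSpace Ω] (P : Measure Ω) (X : ℝ≥0 → Ω → E) : Prop where
  isProbabilityMeasure : IsProbabilityMeasure P
  measurable : ∀ t i, MeasurableSet {ω | X t ω = i}
  right_continuous : ∀ ω t, ∀ᶠ s in 𝓝[≥] t, X s ω = X t ω
  finite_dim : ∀ (n : ℕ) (t : Fin (n + 1) → ℝ≥0) (i : Fin (n + 1) → E),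
    Monotone t → t 0 = 0 →
      P.real {ω | ∀ k, X (t k) ω = i k} =
        π (i 0) * ∏ k : Fin n,
          NormedSpace.exp (((t k.succ : ℝ) - (t k.castSucc : ℝ)) • Q) (i k.castSucc) (i k.succ)

/-- `η` is, under `P`, a discrete-time Markov chain on the finite set `E` with transition
probability matrix `M` and initial distribution `π`. -/
structure IsDiscreteMarkovChain {E : Type*} (M : Matrix E E ℝ) (π : E → ℝ)
    {Ω : Type*} [MeasurableSpace Ω] (P : Measure Ω) (η : ℕ → Ω → E) : Prop where
  isProbabilityMeasure : IsProbabilityMeasure P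
  measurable : ∀ n i, MeasurableSet {ω | η n ω = i}
  finite_dim : ∀ (n : ℕ) (i : Fin (n + 1) → E),
    P.real {ω | ∀ k : Fin (n + 1), η k ω = i k} =
      π (i 0) * ∏ k : Fin n, M (i k.castSucc) (i k.succ)

/-- The first-passage time `inf {n ≥ 0 : η_n ∈ B}`, equal to `⊤` if `B` is never visited. -/
def hittingTime {E Ω : Type*} (η : ℕ → Ω → E) (B : Finset E) (ω : Ω) : ℕ∞ :=
  ⨅ (n : ℕ) (_ : η n ω ∈ B), (n : ℕ∞)

/-- The probability mass function of a random element `Z` under `P`. -/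
def law {E Ω : Type*} [MeasurableSpace Ω] (P : Measure Ω) (Z : Ω → E) (i : E) : ℝ :=
  P.real {ω | Z ω = i}

/-- Total variation distance of two distributions on a finite set. -/
def tvDist {E : Type*} [Fintype E] (μ ν : E → ℝ) : ℝ := (1 / 2) * ∑ i, |μ i - ν i|

/-- The entrywise limit as `lam → ∞`, meaningful at the entries that have a finite limit. -/
def limitMatrix {E : Type*} (Q : ℝ → Matrix E E ℝ) : Matrix E E ℝ :=
  Matrix.of fun i j => limUnder atTop fun lam => Q lam i j

/-- The block of a matrix with rows in `U` and columns in `V`. -/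
def block {E : Type*} (M : Matrix E E ℝ) (U V : Finset E) : Matrix U V ℝ :=
  M.submatrix (fun i => (i : E)) (fun j => (j : E))

section Reduction

variable {S : Type*} [Fintype S]

open scoped Classical in
/-- The set `A` of fast states: `q_i(lam) → ∞`. -/
def fast (Q : ℝ → Matrix S S ℝ) : Finset S :=
  Finset.univ.filter fun i => Tendsto (fun lam => exitRate (Q lam) i) atTop atTop

open scoped Classical in
/-- The set `B` of slow states: `q_i(lam)` has a finite limit. -/
def slow (Q : ℝ → Matrix S S ℝ) : Finset S :=
  Finset.univ.filter fun i => ∃ l : ℝ, Tendsto (fun lam => exitRate (Q lam) i) atTop (𝓝 l)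

variable [DecidableEq S]

/-- The limit `Ω` of the jump matrices. -/
def limitJump (Q : ℝ → Matrix S S ℝ) : Matrix S S ℝ :=
  limitMatrix fun lam => jumpMatrix (Q lam)

/-- The matrix `(I - Ω_AA)⁻¹ Ω_AB`. -/
def passage (Q : ℝ → Matrix S S ℝ) : Matrix (fast Q) (slow Q) ℝ :=
  (1 - block (limitJump Q) (fast Q) (fast Q))⁻¹ * block (limitJump Q) (fast Q) (slow Q)

/-- The rate matrix `Γ = Q_BB + Q_BA (I - Ω_AA)⁻¹ Ω_AB` of the reduced chain. -/
def reducedRate (Q : ℝ → Matrix S S ℝ) : Matrix (slow Q) (slow Q) ℝ :=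
  block (limitMatrix Q) (slow Q) (slow Q) + block (limitMatrix Q) (slow Q) (fast Q) * passage Q

/-- The distribution `γ(π) = π_B + π_A (I - Ω_AA)⁻¹ Ω_AB` on the slow states. -/
def reducedInit (Q : ℝ → Matrix S S ℝ) (π : S → ℝ) : slow Q → ℝ :=
  (fun j : slow Q => π j) + (fun i : fast Q => π i) ᵥ* passage Q

end Reduction

end TwoTimeScale

end

/-! In block form the law of `X` at time `t` is `π exp(tQ)` and that of `Y`, extended by zero, is `π
K exp(tΓ) R`: `R` restricts to the slow states, `K` is the identity on slow rows and `(I - Ω_AA)⁻¹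
Ω_AB` on fast rows, so `γ(π) = π K`. In the maximal row sum norm it suffices that `exp(tQ) - K
exp(tΓ) R` tends to zero uniformly for `t ≥ h`. Times near `0` are excluded because `K R ≠ 1` when
there are fast states.

Three facts give this (`eventually_norm_exp_sub_le`). (1) There is `J → K` with `Q J - J Γ → 0`, so
Duhamel's formula gives `exp(tQ) J ≈ K exp(tΓ)` on bounded time intervals. `K` itself need not work,
since the fast rows of `Q` blow up; `exists_correctors` perturbs it. (2) After any positive time the
fast states carry little mass. The mean time `v` spent in `A` before entering `B` tends to zero and
`Q v ≈ -1_A`, while the rate of entering `A` stays bounded; see `exp_mulVec_le_of_lyapunov`. (3)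
`exp(TΓ)` contracts matrices with vanishing row sums, because `Γ` is irreducible. This carries the
estimate at one large time `T` to all later times (`exists_time_contraction`).

Almost sure passage to `B` makes `I - Ω_AA` invertible with nonnegative inverse, so `Γ` is a rate
matrix. -/

noncomputable section

namespace TwoTimeScale

set_option linter.unusedSectionVars false

open scoped Matrix.Norms.Operator
open NormedSpace (exp)

/-! ### Semigroups of rate matrices in the row sum norm. -/

section Semigroup

variable {E F : Type*} [Fintype E] [DecidableEq E] [Fintype F] [DecidableEq F]

theorem linfty_norm_le {m n : Type*} [Fintype m] [Fintype n] {M : Matrix m n ℝ} {c : ℝ}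
    (hc : 0 ≤ c) (h : ∀ i, ∑ j, |M i j| ≤ c) : ‖M‖ ≤ c := by
  rw [Matrix.linfty_opNorm_def]
  lift c to ℝ≥0 using hc
  refine NNReal.coe_le_coe.2 (Finset.sup_le fun i _ => ?_)
  rw [← NNReal.coe_le_coe]
  push_cast
  simpa using h i

theorem row_abs_sum_le_norm {m n : Type*} [Fintype m] [Fintype n] (M : Matrix m n ℝ) (i : m) :
    ∑ j, |M i j| ≤ ‖M‖ := by
  rw [Matrix.linfty_opNorm_def]
  have := Finset.le_sup (f := fun i => ∑ j, ‖M i j‖₊) (Finset.mem_univ i)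
  have h2 := NNReal.coe_le_coe.2 this
  push_cast at h2
  simpa using h2

theorem norm_le_one_of_mem_rowStochastic {M : Matrix E E ℝ}
    (hM : M ∈ Matrix.rowStochastic ℝ E) : ‖M‖ ≤ 1 := by
  refine linfty_norm_le zero_le_one fun i => ?_
  rw [← Matrix.sum_row_of_mem_rowStochastic hM i]
  exact (Finset.sum_congr rfl fun j _ =>
    abs_of_nonneg (Matrix.nonneg_of_mem_rowStochastic hM)).le

theorem hasSum_exp_apply (N : Matrix E E ℝ) (i j : E) :
    HasSum (fun n : ℕ => (n.factorial : ℝ)⁻¹ * (N ^ n) i j) (exp N i j) := by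
  have h := NormedSpace.exp_series_hasSum_exp' (𝕂 := ℝ) N
  have h2 := h.map (Matrix.entryAddMonoidHom ℝ i j)
    (continuous_id.matrix_elem i j)
  exact h2

theorem pow_apply_nonneg {N : Matrix E E ℝ} (hN : ∀ i j, 0 ≤ N i j) (n : ℕ) (i j : E) :
    0 ≤ (N ^ n) i j := by
  induction n generalizing j with
  | zero => rw [pow_zero, Matrix.one_apply]; split_ifs <;> norm_num
  | succ n ih =>
    rw [pow_succ, Matrix.mul_apply]
    exact Finset.sum_nonneg fun k _ => mul_nonneg (ih k) (hN k j)

theorem exp_apply_nonneg_of_nonneg {N : Matrix E E ℝ} (hN : ∀ i j, 0 ≤ N i j) (i j : E) :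
    0 ≤ exp N i j :=
  (hasSum_exp_apply N i j).nonneg fun n =>
    mul_nonneg (by positivity) (pow_apply_nonneg hN n i j)

theorem exp_apply_pos_of_pow_apply_pos {N : Matrix E E ℝ} (hN : ∀ i j, 0 ≤ N i j) {i j : E}
    {n : ℕ} (h : 0 < (N ^ n) i j) : 0 < exp N i j := by
  have h1 := (hasSum_exp_apply N i j)
  have h2 := h1.summable.le_tsum n fun m _ =>
    mul_nonneg (by positivity : (0 : ℝ) ≤ (m.factorial : ℝ)⁻¹) (pow_apply_nonneg hN m i j)
  rw [h1.tsum_eq] at h2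
  exact lt_of_lt_of_le (by positivity) h2

/-- A multiple of the identity commutes with `G`, so the shift costs only a scalar factor;
positivity of `exp G` can then be read off a power series with nonnegative terms. -/
theorem IsRateMatrix.exists_shift_nonneg {G : Matrix E E ℝ} (hG : IsRateMatrix G) :
    ∃ c : ℝ, (∀ i j, 0 ≤ (G + c • (1 : Matrix E E ℝ)) i j) ∧
      exp G = Real.exp (-c) • exp (G + c • (1 : Matrix E E ℝ)) := by
  refine ⟨∑ i, |G i i|, fun i j => ?_, ?_⟩
  · rcases eq_or_ne i j with rfl | hij
    · have := Finset.single_le_sum (f := fun i => |G i i|) (fun i _ => abs_nonneg _)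
        (Finset.mem_univ i)
      have h2 := neg_abs_le (G i i)
      simp only [Matrix.add_apply, Matrix.smul_apply, Matrix.one_apply_eq, smul_eq_mul, mul_one]
      linarith
    · simpa [Matrix.one_apply_ne hij] using hG.nonneg i j hij
  · set c := ∑ i, |G i i|
    have hexp : exp ((-c) • (1 : Matrix E E ℝ)) = Real.exp (-c) • (1 : Matrix E E ℝ) := by
      rw [← Algebra.algebraMap_eq_smul_one, ← Algebra.algebraMap_eq_smul_one,
        Real.exp_eq_exp_ℝ, NormedSpace.algebraMap_exp_comm]
      rfl
    have hcomm : Commute (G + c • (1 : Matrix E E ℝ)) ((-c) • (1 : Matrix E E ℝ)) :=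
      (Commute.one_right _).smul_right _
    have := Matrix.exp_add_of_commute _ _ hcomm
    rw [hexp] at this
    simpa using this

theorem IsRateMatrix.smul {G : Matrix E E ℝ} (hG : IsRateMatrix G) {t : ℝ} (ht : 0 ≤ t) :
    IsRateMatrix (t • G) where
  nonneg i j hij := mul_nonneg ht (hG.nonneg i j hij)
  row_sum i := by
    simp only [Matrix.smul_apply, smul_eq_mul, ← Finset.mul_sum, hG.row_sum i, mul_zero]

theorem IsRateMatrix.mulVec_one {G : Matrix E E ℝ} (hG : IsRateMatrix G) :
    G *ᵥ (1 : E → ℝ) = 0 := by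
  ext i
  simpa [Matrix.mulVec, dotProduct] using hG.row_sum i

theorem hasDerivAt_exp_smul_mulVec_apply (G : Matrix E E ℝ) {w : ℝ → E → ℝ} {w' : E → ℝ} {t : ℝ}
    (hw : HasDerivAt w w' t) (i : E) :
    HasDerivAt (fun s : ℝ => (exp (s • G) *ᵥ w s) i)
      ((exp (t • G) *ᵥ (G *ᵥ w t + w')) i) t := by
  have h1 : ∀ j, HasDerivAt (fun s : ℝ => exp (s • G) i j) ((exp (t • G) * G) i j) t := fun j =>
    ((Matrix.entryLinearMap ℝ ℝ i j).toContinuousLinearMap.hasFDerivAt).comp_hasDerivAt t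
      (hasDerivAt_exp_smul_const G t)
  have h2 := HasDerivAt.fun_sum (u := Finset.univ)
    fun j _ => (h1 j).mul (hasDerivAt_pi.1 hw j)
  refine (h2.congr_deriv ?_)
  rw [Matrix.mulVec_add, Matrix.mulVec_mulVec, Finset.sum_add_distrib]
  rfl

theorem IsRateMatrix.exp_mulVec_one {G : Matrix E E ℝ} (hG : IsRateMatrix G) :
    exp G *ᵥ (1 : E → ℝ) = 1 := by
  ext i
  have h := is_const_of_deriv_eq_zero (f := fun s : ℝ => (exp (s • G) *ᵥ (1 : E → ℝ)) i)
    (fun s => (hasDerivAt_exp_smul_mulVec_apply G (hasDerivAt_const s 1) i).differentiableAt)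
    (fun s => by
      rw [(hasDerivAt_exp_smul_mulVec_apply G (hasDerivAt_const s 1) i).deriv]
      simp [hG.mulVec_one]) 1 0
  simpa using h

theorem IsRateMatrix.exp_mem_rowStochastic {G : Matrix E E ℝ} (hG : IsRateMatrix G) :
    exp G ∈ Matrix.rowStochastic ℝ E := by
  refine ⟨fun i j => ?_, hG.exp_mulVec_one⟩
  obtain ⟨c, hc, he⟩ := hG.exists_shift_nonneg
  rw [he]
  exact mul_nonneg (Real.exp_pos _).le (exp_apply_nonneg_of_nonneg hc i j)

theorem IsRateMatrix.exp_smul_mem_rowStochastic {G : Matrix E E ℝ} (hG : IsRateMatrix G) {t : ℝ}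
    (ht : 0 ≤ t) : exp (t • G) ∈ Matrix.rowStochastic ℝ E :=
  (hG.smul ht).exp_mem_rowStochastic

theorem IsRateMatrix.norm_exp_smul_le_one {G : Matrix E E ℝ} (hG : IsRateMatrix G) {t : ℝ}
    (ht : 0 ≤ t) : ‖exp (t • G)‖ ≤ 1 :=
  norm_le_one_of_mem_rowStochastic (hG.exp_smul_mem_rowStochastic ht)

theorem exp_add_smul (G : Matrix E E ℝ) (s t : ℝ) :
    exp ((s + t) • G) = exp (s • G) * exp (t • G) := by
  rw [add_smul]
  exact Matrix.exp_add_of_commute _ _ (((Commute.refl G).smul_left s).smul_right t)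

theorem IsRateMatrix.exp_mulVec_mono {G : Matrix E E ℝ} (hG : IsRateMatrix G) {t : ℝ}
    (ht : 0 ≤ t) {f g : E → ℝ} (hfg : ∀ j, f j ≤ g j) (i : E) :
    (exp (t • G) *ᵥ f) i ≤ (exp (t • G) *ᵥ g) i :=
  Finset.sum_le_sum fun j _ => mul_le_mul_of_nonneg_left (hfg j)
    (Matrix.nonneg_of_mem_rowStochastic (hG.exp_smul_mem_rowStochastic ht))

theorem IsRateMatrix.exp_mulVec_const {G : Matrix E E ℝ} (hG : IsRateMatrix G) {t : ℝ}
    (ht : 0 ≤ t) (c : ℝ) (i : E) : (exp (t • G) *ᵥ fun _ => c) i = c := by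
  have : (fun _ : E => c) = c • (1 : E → ℝ) := by ext; simp
  rw [this, Matrix.mulVec_smul, (hG.smul ht).exp_mulVec_one]
  simp

theorem hasDerivAt_matrix_mul {l m n : Type*} [Fintype l] [Fintype m] [Fintype n]
    {U : ℝ → Matrix l m ℝ} {V : ℝ → Matrix m n ℝ} {U' : Matrix l m ℝ} {V' : Matrix m n ℝ} {t : ℝ}
    (hU : HasDerivAt U U' t) (hV : HasDerivAt V V' t) :
    HasDerivAt (fun s => U s * V s) (U' * V t + U t * V') t := by
  have hL : IsBoundedBilinearMap ℝ fun p : Matrix l m ℝ × Matrix m n ℝ => p.1 * p.2 :=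
    { add_left := Matrix.add_mul
      smul_left := Matrix.smul_mul
      add_right := Matrix.mul_add
      smul_right := fun c U V => Matrix.mul_smul U c V
      bound := ⟨1, one_pos, fun U V => by
        rw [one_mul]
        exact Matrix.linfty_opNorm_mul U V⟩ }
  have h := (hL.hasFDerivAt (U t, V t)).comp_hasDerivAt t (hU.prodMk hV)
  rw [add_comm]
  exact h

/-- Duhamel's estimate for two semigroups that are approximately intertwined by `J`. -/
theorem norm_exp_mul_sub_mul_exp_le {G : Matrix E E ℝ} {H : Matrix F F ℝ} (hG : IsRateMatrix G)
    (hH : IsRateMatrix H) (J : Matrix E F ℝ) {t : ℝ} (ht : 0 ≤ t) :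
    ‖exp (t • G) * J - J * exp (t • H)‖ ≤ t * ‖G * J - J * H‖ := by
  -- This path joins `J * exp (t • H)` at `s = 0` to `exp (t • G) * J` at `s = t`; both semigroups
  -- are contractions, so its speed is at most the intertwining defect.
  have hder : ∀ s : ℝ, HasDerivAt (fun s : ℝ => exp (s • G) * (J * exp ((t - s) • H)))
      (exp (s • G) * (G * J - J * H) * exp ((t - s) • H)) s := fun s => by
    have h1 := hasDerivAt_exp_smul_const G s
    have h2 := (hasDerivAt_exp_smul_const' H (t - s)).scomp s ((hasDerivAt_id s).const_sub t)
    refine (hasDerivAt_matrix_mul h1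
      (hasDerivAt_matrix_mul (hasDerivAt_const s J) h2)).congr_deriv ?_
    simp only [sub_eq_add_neg, Matrix.mul_add, Matrix.add_mul, Matrix.mul_assoc, Matrix.mul_neg,
      Matrix.neg_mul, Matrix.zero_mul, zero_add, neg_smul, one_smul,
      Function.comp_apply]
    rfl
  have := norm_image_sub_le_of_norm_deriv_le_segment' (a := 0) (b := t)
    (C := ‖G * J - J * H‖) (fun s _ => (hder s).hasDerivWithinAt) (fun s hs => ?_) t ⟨ht, le_rfl⟩
  · simpa [mul_comm] using this
  · calc _ ≤ ‖exp (s • G)‖ * ‖G * J - J * H‖ * ‖exp ((t - s) • H)‖ :=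
          (Matrix.linfty_opNorm_mul _ _).trans
            (mul_le_mul_of_nonneg_right (Matrix.linfty_opNorm_mul _ _) (norm_nonneg _))
      _ ≤ 1 * ‖G * J - J * H‖ * 1 := by
          gcongr
          · exact hG.norm_exp_smul_le_one hs.1
          · exact hH.norm_exp_smul_le_one (sub_nonneg.2 hs.2.le)
      _ = _ := by ring

/-- A Lyapunov bound for the probability of being in a set that is left quickly. -/
theorem exp_mulVec_le_of_lyapunov {G : Matrix E E ℝ} (hG : IsRateMatrix G) {a v : E → ℝ}
    {C ε η : ℝ} (hC : 0 ≤ C) (ha : ∀ i, (G *ᵥ a) i ≤ C) (hv : ∀ i, (G *ᵥ v) i ≤ -a i + ε)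
    (hvη : ∀ i, |v i| ≤ η) {d t : ℝ} (hd : 0 < d) (hdt : d ≤ t) (i : E) :
    (exp (t • G) *ᵥ a) i ≤ 2 * η / d + C * d + ε := by
  have key : ∀ i, (exp (d • G) *ᵥ a) i ≤ 2 * η / d + C * d + ε := by
    intro i
    -- The derivative applies the semigroup to `s • G a + (G v + a)`, at most `C * d + ε` on `[0,
    -- d]`. Integrating bounds `d * exp (d • G) a` up to the two boundary terms in `v`, each at most
    -- `η`.
    have hder : ∀ s : ℝ, HasDerivAt (fun s : ℝ => (exp (s • G) *ᵥ (s • a + v)) i)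
        ((exp (s • G) *ᵥ (G *ᵥ (s • a + v) + a)) i) s := fun s =>
      hasDerivAt_exp_smul_mulVec_apply G
        (by simpa using ((hasDerivAt_id s).smul_const a).add_const v) i
    have hle := (convex_Icc (0 : ℝ) d).image_sub_le_mul_sub_of_deriv_le
      (f := fun s : ℝ => (exp (s • G) *ᵥ (s • a + v)) i) (C := C * d + ε)
      (fun s _ => (hder s).continuousAt.continuousWithinAt)
      (fun s _ => (hder s).differentiableAt.differentiableWithinAt)
      (fun s hs => by
        rw [interior_Icc] at hs
        rw [(hder s).deriv]
        refine (hG.exp_mulVec_mono hs.1.le (g := fun _ => C * d + ε) (fun j => ?_) i).trans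
          (hG.exp_mulVec_const hs.1.le _ i).le
        have h1 : s * (G *ᵥ a) j ≤ s * C := mul_le_mul_of_nonneg_left (ha j) hs.1.le
        have h2 : s * C ≤ d * C := mul_le_mul_of_nonneg_right hs.2.le hC
        have h3 := hv j
        simp only [Matrix.mulVec_add, Matrix.mulVec_smul, Pi.add_apply, Pi.smul_apply, smul_eq_mul]
        linarith) 0 ⟨le_rfl, hd.le⟩ d ⟨hd.le, le_rfl⟩ hd.le
    have h0 : (exp ((0 : ℝ) • G) *ᵥ ((0 : ℝ) • a + v)) i = v i := by simp
    have h1 : -η ≤ (exp (d • G) *ᵥ v) i := by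
      rw [← hG.exp_mulVec_const hd.le (-η) i]
      exact hG.exp_mulVec_mono hd.le (fun j => (abs_le.1 (hvη j)).1) i
    have h2 := (abs_le.1 (hvη i)).2
    simp only [h0, Matrix.mulVec_add, Matrix.mulVec_smul, Pi.add_apply, Pi.smul_apply,
      smul_eq_mul] at hle
    have h3 : d * (exp (d • G) *ᵥ a) i ≤ 2 * η + (C * d + ε) * d := by linarith
    rw [← sub_nonneg]
    have : 2 * η / d + C * d + ε - (exp (d • G) *ᵥ a) i
        = (2 * η + (C * d + ε) * d - d * (exp (d • G) *ᵥ a) i) / d := by field_simp; ring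
    rw [this]
    exact div_nonneg (by linarith) hd.le
  -- The bound at time `d` holds from every state, so averaging over the state at time `t - d`
  -- preserves it.
  have hsplit : exp (t • G) *ᵥ a = exp ((t - d) • G) *ᵥ (exp (d • G) *ᵥ a) := by
    rw [Matrix.mulVec_mulVec, ← exp_add_smul, sub_add_cancel]
  rw [hsplit, ← hG.exp_mulVec_const (sub_nonneg.2 hdt) (2 * η / d + C * d + ε) i]
  exact hG.exp_mulVec_mono (sub_nonneg.2 hdt) key i

theorem exp_apply_pos_of_irreducible {G : Matrix E E ℝ} (hG : IsRateMatrix G)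
    (hirr : IsIrreducibleRate G) (i j : E) : 0 < exp G i j := by
  obtain ⟨c, hc, he⟩ := hG.exists_shift_nonneg
  -- A path of `n` positive rates contributes a positive term to the `n`-th power.
  have hpow : ∃ n : ℕ, 0 < ((G + c • (1 : Matrix E E ℝ)) ^ n) i j := by
    induction hirr i j with
    | refl => exact ⟨0, by simp⟩
    | @tail k l _ hbc ih =>
      obtain ⟨n, hn⟩ := ih
      refine ⟨n + 1, ?_⟩
      rw [pow_succ, Matrix.mul_apply]
      refine lt_of_lt_of_le ?_ (Finset.single_le_sum
        (fun m _ => mul_nonneg (pow_apply_nonneg hc n i m) (hc m l)) (Finset.mem_univ k))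
      refine mul_pos hn ?_
      simpa [Matrix.one_apply_ne hbc.1] using hbc.2
  obtain ⟨n, hn⟩ := hpow
  rw [he]
  exact mul_pos (Real.exp_pos _) (exp_apply_pos_of_pow_apply_pos hc hn)

/-- A stochastic matrix with positive entries contracts matrices with vanishing row sums. -/
theorem exists_contraction_of_pos [Nonempty E] {P : Matrix E E ℝ}
    (hP : P ∈ Matrix.rowStochastic ℝ E) (hpos : ∀ i j, 0 < P i j) :
    ∃ ρ : ℝ, 0 ≤ ρ ∧ ρ < 1 ∧ ∀ {m : Type _} [Fintype m] (M : Matrix m E ℝ),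
      M *ᵥ (1 : E → ℝ) = 0 → ‖M * P‖ ≤ ρ * ‖M‖ := by
  obtain ⟨⟨i₀, j₀⟩, hmin⟩ := Finite.exists_min fun p : E × E => P p.1 p.2
  set β := P i₀ j₀
  -- Doeblin minorization: `U` has constant entries, so it kills matrices with zero row sums, and `P
  -- - U` is nonnegative with row sums `1 - |E| β < 1`.
  let U : Matrix E E ℝ := Matrix.of fun _ _ => β
  have hcard : (0 : ℝ) < Fintype.card E := by exact_mod_cast Fintype.card_pos
  have hrow : ∀ i, ∑ j, |(P - U) i j| = 1 - Fintype.card E * β := fun i => by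
    have h1 : ∀ j, |(P - U) i j| = P i j - β := fun j =>
      abs_of_nonneg (sub_nonneg.2 (hmin (i, j)))
    rw [Finset.sum_congr rfl fun j _ => h1 j, Finset.sum_sub_distrib,
      Matrix.sum_row_of_mem_rowStochastic hP i]
    simp
  have hnorm : ‖P - U‖ ≤ 1 - Fintype.card E * β :=
    linfty_norm_le (by rw [← hrow i₀]; positivity) fun i => (hrow i).le
  refine ⟨‖P - U‖, norm_nonneg _, hnorm.trans_lt ?_, fun {m} _ M hM => ?_⟩
  · have := mul_pos hcard (hpos i₀ j₀)
    simp only [β]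
    linarith
  · have hMU : M * U = 0 := by
      ext i j
      have := congrFun hM i
      simp only [Matrix.mulVec, dotProduct, Pi.one_apply, mul_one, Pi.zero_apply] at this
      simp [Matrix.mul_apply, U, ← Finset.sum_mul, this]
    calc ‖M * P‖ = ‖M * (P - U)‖ := by rw [Matrix.mul_sub, hMU, sub_zero]
      _ ≤ ‖M‖ * ‖P - U‖ := Matrix.linfty_opNorm_mul _ _
      _ = _ := mul_comm _ _

/-- The semigroup of an irreducible rate matrix forgets its initial distribution. -/
theorem exists_time_contraction [Nonempty E] {G : Matrix E E ℝ} (hG : IsRateMatrix G)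
    (hirr : IsIrreducibleRate G) (h : ℝ) {ε : ℝ} (hε : 0 < ε) :
    ∃ T : ℝ, 0 ≤ T ∧ h ≤ T ∧ ∀ {m : Type _} [Fintype m] (M : Matrix m E ℝ),
      M *ᵥ (1 : E → ℝ) = 0 → ‖M * exp (T • G)‖ ≤ ε * ‖M‖ := by
  obtain ⟨ρ, hρ, hρ1, hcon⟩ := exists_contraction_of_pos hG.exp_mem_rowStochastic
    (exp_apply_pos_of_irreducible hG hirr)
  obtain ⟨n, hn, hhn⟩ := (((tendsto_pow_atTop_nhds_zero_of_lt_one hρ hρ1).eventually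
    (gt_mem_nhds hε)).and (eventually_ge_atTop ⌈h⌉₊)).exists
  refine ⟨n, n.cast_nonneg, Nat.ceil_le.1 hhn, fun {m} _ M hM => ?_⟩
  have hpow : exp ((n : ℝ) • G) = exp G ^ n := by
    rw [Nat.cast_smul_eq_nsmul, Matrix.exp_nsmul]
  have hiter : ∀ k : ℕ, ‖M * exp G ^ k‖ ≤ ρ ^ k * ‖M‖ ∧ (M * exp G ^ k) *ᵥ (1 : E → ℝ) = 0 := by
    intro k
    induction k with
    | zero => simp [hM]
    | succ k ih =>
      rw [pow_succ, ← Matrix.mul_assoc]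
      refine ⟨(hcon _ ih.2).trans ?_, ?_⟩
      · rw [pow_succ', mul_assoc]
        exact mul_le_mul_of_nonneg_left ih.1 hρ
      · rw [← Matrix.mulVec_mulVec, hG.exp_mulVec_one, ih.2]
  rw [hpow]
  exact (hiter n).1.trans (mul_le_mul_of_nonneg_right hn.le (norm_nonneg _))

end Semigroup

/-! ### Abstract convergence of semigroups from correctors. -/

section Convergence

variable {E F ι : Type*} [Fintype E] [DecidableEq E] [Fintype F] [DecidableEq F] {l : Filter ι}
  {Q : ι → Matrix E E ℝ}

/-- After any positive time the chain has left the states on which `a` is supported. -/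
theorem eventually_norm_exp_mul_diagonal_le (hQ : ∀ᶠ x in l, IsRateMatrix (Q x)) {a : E → ℝ}
    {v : ι → E → ℝ} {C : ℝ} (hC : 0 ≤ C) (ha₀ : ∀ i, 0 ≤ a i)
    (ha : ∀ᶠ x in l, ∀ i, (Q x *ᵥ a) i ≤ C) (hv : Tendsto v l (𝓝 0))
    (hQv : Tendsto (fun x => Q x *ᵥ v x + a) l (𝓝 0)) {h ε : ℝ} (hh : 0 < h) (hε : 0 < ε) :
    ∀ᶠ x in l, ∀ t, h ≤ t → ‖exp (t • Q x) * Matrix.diagonal a‖ ≤ ε := by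
  -- The Lyapunov bound `2η/d + C d + ε/3` is split into thirds: this `d` controls the middle term,
  -- and `η = ε d / 6` makes the first one `ε / 3`.
  set d := min h (ε / (3 * (C + 1)))
  have hd : 0 < d := lt_min hh (by positivity)
  have hCd : C * d ≤ ε / 3 := by
    have h1 : d ≤ ε / (3 * (C + 1)) := min_le_right _ _
    calc C * d ≤ (C + 1) * (ε / (3 * (C + 1))) := by gcongr; linarith
      _ = ε / 3 := by field_simp
  have hv' : ∀ᶠ x in l, ‖v x‖ < ε * d / 6 := by
    have := hv.norm
    rw [norm_zero] at this
    exact this.eventually (gt_mem_nhds (by positivity))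
  have hQv' : ∀ᶠ x in l, ‖Q x *ᵥ v x + a‖ < ε / 3 := by
    have := hQv.norm
    rw [norm_zero] at this
    exact this.eventually (gt_mem_nhds (by positivity))
  filter_upwards [hQ, ha, hv', hQv'] with x hQx hax hvx hQvx t ht
  have hdt : d ≤ t := (min_le_left _ _).trans ht
  have hst := hQx.exp_smul_mem_rowStochastic (hd.le.trans hdt)
  refine linfty_norm_le hε.le fun i => ?_
  have hsum : ∑ j, |(exp (t • Q x) * Matrix.diagonal a) i j| = (exp (t • Q x) *ᵥ a) i :=
    Finset.sum_congr rfl fun j _ => by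
      rw [Matrix.mul_diagonal]
      exact abs_of_nonneg (mul_nonneg (Matrix.nonneg_of_mem_rowStochastic hst) (ha₀ j))
  rw [hsum]
  have := exp_mulVec_le_of_lyapunov (ε := ε / 3) (η := ε * d / 6) hQx hC hax (fun i => by
    have h1 := (Real.norm_eq_abs _ ▸ norm_le_pi_norm (Q x *ᵥ v x + a) i).trans hQvx.le
    have h2 := (abs_le.1 h1).2
    rw [Pi.add_apply] at h2
    linarith) (fun i => (Real.norm_eq_abs _ ▸ norm_le_pi_norm (v x) i).trans hvx.le) hd hdt i
  have h3 : 2 * (ε * d / 6) / d = ε / 3 := by field_simp; ring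
  linarith

theorem eventually_norm_exp_mul_sub_le (hQ : ∀ᶠ x in l, IsRateMatrix (Q x)) {G : Matrix F F ℝ}
    (hG : IsRateMatrix G) {J : ι → Matrix E F ℝ} {K : Matrix E F ℝ} (hJ : Tendsto J l (𝓝 K))
    (hQJ : Tendsto (fun x => Q x * J x - J x * G) l (𝓝 0)) (T : ℝ) {ε : ℝ} (hε : 0 < ε) :
    ∀ᶠ x in l, ∀ t, 0 ≤ t → t ≤ T → ‖exp (t • Q x) * J x - K * exp (t • G)‖ ≤ ε := by
  have hlim : Tendsto (fun x => T * ‖Q x * J x - J x * G‖ + ‖J x - K‖) l (𝓝 0) := by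
    have := (hQJ.norm.const_mul T).add (hJ.sub_const K).norm
    simpa using this
  filter_upwards [hQ, hlim.eventually (gt_mem_nhds hε)] with x hQx hx t ht htT
  calc ‖exp (t • Q x) * J x - K * exp (t • G)‖
      = ‖(exp (t • Q x) * J x - J x * exp (t • G)) + (J x - K) * exp (t • G)‖ := by
        rw [Matrix.sub_mul, sub_add_sub_cancel]
    _ ≤ ‖exp (t • Q x) * J x - J x * exp (t • G)‖ + ‖(J x - K) * exp (t • G)‖ := norm_add_le _ _
    _ ≤ t * ‖Q x * J x - J x * G‖ + ‖J x - K‖ * ‖exp (t • G)‖ :=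
        add_le_add (norm_exp_mul_sub_mul_exp_le hQx hG (J x) ht) (Matrix.linfty_opNorm_mul _ _)
    _ ≤ T * ‖Q x * J x - J x * G‖ + ‖J x - K‖ * 1 := by
        gcongr
        exact hG.norm_exp_smul_le_one ht
    _ ≤ ε := by rw [mul_one]; exact hx.le

/-- Convergence of semigroups with fast states, uniformly on `[h, ∞)`. Here `K` extends functions
from the slow states by averaging, `R` restricts to the slow states, `a` is supported on the fast
states, and `J` and `v` are correctors. -/
theorem eventually_norm_exp_sub_le [Nonempty F] (hQ : ∀ᶠ x in l, IsRateMatrix (Q x))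
    {G : Matrix F F ℝ} (hG : IsRateMatrix G) (hirr : IsIrreducibleRate G)
    {J : ι → Matrix E F ℝ} {K : Matrix E F ℝ} {R : Matrix F E ℝ} (hJ : Tendsto J l (𝓝 K))
    (hQJ : Tendsto (fun x => Q x * J x - J x * G) l (𝓝 0)) (hK : K *ᵥ (1 : F → ℝ) = 1)
    {a : E → ℝ} {v : ι → E → ℝ} {C : ℝ} (hC : 0 ≤ C) (ha₀ : ∀ i, 0 ≤ a i)
    (ha : ∀ᶠ x in l, ∀ i, (Q x *ᵥ a) i ≤ C) (hv : Tendsto v l (𝓝 0))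
    (hQv : Tendsto (fun x => Q x *ᵥ v x + a) l (𝓝 0))
    (hJR : ∀ x, Matrix.diagonal a * (1 - J x * R) = 1 - J x * R)
    {h ε : ℝ} (hh : 0 < h) (hε : 0 < ε) :
    ∀ᶠ x in l, ∀ t, h ≤ t → ‖exp (t • Q x) - K * exp (t • G) * R‖ ≤ ε := by
  -- For late times the contracted term is at most `ε' * (2 * ‖K‖) * ‖R‖`, hence at most `ε / 2`.
  set ε' := ε / 2 / (2 * ‖K‖ * ‖R‖ + 1)
  have hε' : 0 < ε' := by positivity
  obtain ⟨T, hT0, hhT, hT⟩ := exists_time_contraction hG hirr h hε'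
  have hbd : ∀ᶠ x in l, ‖1 - J x * R‖ < ‖1 - K * R‖ + 1 := by
    have hc : Continuous fun M : Matrix E F ℝ => ‖(1 : Matrix E E ℝ) - M * R‖ :=
      (continuous_const.sub (continuous_id.matrix_mul continuous_const)).norm
    exact ((hc.tendsto K).comp hJ).eventually (gt_mem_nhds (lt_add_one _))
  set c := ‖1 - K * R‖ + 1
  have hc : 0 < c := by positivity
  have hcompact : ∀ᶠ x in l, ∀ t, h ≤ t → t ≤ T →
      ‖exp (t • Q x) - K * exp (t • G) * R‖ ≤ ε / 2 := by
    filter_upwards [hbd, eventually_norm_exp_mul_sub_le hQ hG hJ hQJ T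
      (show 0 < ε / 4 / (‖R‖ + 1) by positivity),
      eventually_norm_exp_mul_diagonal_le hQ hC ha₀ ha hv hQv hh (show 0 < ε / 4 / c by positivity)]
      with x h1 h2 h3 t ht htT
    -- The identity is split as `J R + (1 - J R)`; the second summand lives on the fast rows, where
    -- little mass remains.
    have hdec : exp (t • Q x) - K * exp (t • G) * R
        = (exp (t • Q x) * J x - K * exp (t • G)) * R
          + exp (t • Q x) * Matrix.diagonal a * (1 - J x * R) := by
      rw [Matrix.mul_assoc _ (Matrix.diagonal a), hJR]
      simp only [Matrix.mul_sub, Matrix.sub_mul, Matrix.mul_assoc, Matrix.mul_one]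
      abel
    calc ‖exp (t • Q x) - K * exp (t • G) * R‖
        ≤ ‖exp (t • Q x) * J x - K * exp (t • G)‖ * ‖R‖
          + ‖exp (t • Q x) * Matrix.diagonal a‖ * ‖1 - J x * R‖ := by
          rw [hdec]
          exact (norm_add_le _ _).trans
            (add_le_add (Matrix.linfty_opNorm_mul _ _) (Matrix.linfty_opNorm_mul _ _))
      _ ≤ ε / 4 / (‖R‖ + 1) * (‖R‖ + 1) + ε / 4 / c * c := by
          gcongr
          · exact h2 t (hh.le.trans ht) htT
          · linarith
          · exact h3 t ht
      _ = ε / 2 := by field_simp; ring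
  filter_upwards [hQ, hcompact] with x hQx hx t ht
  rcases le_total t T with htT | hTt
  · exact (hx t ht htT).trans (by linarith)
  · have hs : 0 ≤ t - T := sub_nonneg.2 hTt
    set M := exp ((t - T) • Q x) * K - K * exp ((t - T) • G)
    have hM : M *ᵥ (1 : F → ℝ) = 0 := by
      rw [Matrix.sub_mulVec, ← Matrix.mulVec_mulVec, ← Matrix.mulVec_mulVec, hK,
        (hQx.smul hs).exp_mulVec_one, (hG.smul hs).exp_mulVec_one, hK, sub_self]
    have hMn : ‖M‖ ≤ 2 * ‖K‖ :=
      calc ‖M‖ ≤ ‖exp ((t - T) • Q x)‖ * ‖K‖ + ‖K‖ * ‖exp ((t - T) • G)‖ :=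
            (norm_sub_le _ _).trans
              (add_le_add (Matrix.linfty_opNorm_mul _ _) (Matrix.linfty_opNorm_mul _ _))
        _ ≤ 1 * ‖K‖ + ‖K‖ * 1 := by
            gcongr
            · exact hQx.norm_exp_smul_le_one hs
            · exact hG.norm_exp_smul_le_one hs
        _ = 2 * ‖K‖ := by ring
    -- The error at time `T` is transported by a contraction. The remaining discrepancy `M` need not
    -- be small, but its row sums vanish, so `exp (T • G)` shrinks it.
    have hdec : exp (t • Q x) - K * exp (t • G) * R
        = exp ((t - T) • Q x) * (exp (T • Q x) - K * exp (T • G) * R)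
          + M * exp (T • G) * R := by
      have h1 : exp (t • Q x) = exp ((t - T) • Q x) * exp (T • Q x) := by
        rw [← exp_add_smul, sub_add_cancel]
      have h2 : exp (t • G) = exp ((t - T) • G) * exp (T • G) := by
        rw [← exp_add_smul, sub_add_cancel]
      rw [h1, h2]
      simp only [M, Matrix.mul_sub, Matrix.sub_mul, Matrix.mul_assoc]
      abel
    calc ‖exp (t • Q x) - K * exp (t • G) * R‖
        ≤ ‖exp ((t - T) • Q x)‖ * ‖exp (T • Q x) - K * exp (T • G) * R‖
          + ‖M * exp (T • G)‖ * ‖R‖ := by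
          rw [hdec]
          exact (norm_add_le _ _).trans
            (add_le_add (Matrix.linfty_opNorm_mul _ _) (Matrix.linfty_opNorm_mul _ _))
      _ ≤ 1 * (ε / 2) + ε' * (2 * ‖K‖) * ‖R‖ := by
          gcongr
          · exact hQx.norm_exp_smul_le_one hs
          · exact hx T hhT le_rfl
          · exact (hT M hM).trans (by gcongr)
      _ ≤ 1 * (ε / 2) + ε' * (2 * ‖K‖ * ‖R‖ + 1) := by linarith
      _ = ε := by
          simp only [ε']
          field_simp
          ring

end Convergence

/-! ### Almost sure passage to the slow states and the inverse of `I - Ω_AA`. -/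

section Absorption

/-- Summing out the first state of a path replaces `f` by `f ᵥ* M`, which is why the induction
generalizes over `f`. -/
theorem sum_path_prod_eq_dotProduct_pow {A : Type*} [Fintype A] [DecidableEq A]
    (M : Matrix A A ℝ) (n : ℕ) (f : A → ℝ) :
    ∑ p : Fin (n + 1) → A, f (p 0) * ∏ k : Fin n, M (p k.castSucc) (p k.succ)
      = f ⬝ᵥ (M ^ n *ᵥ 1) := by
  induction n generalizing f with
  | zero =>
    rw [← (Equiv.funUnique (Fin 1) A).symm.sum_comp]
    simp [dotProduct]
  | succ n ih =>
    rw [← (Fin.consEquiv fun _ => A).sum_comp, Fintype.sum_prod_type, Finset.sum_comm]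
    have h : ∀ p : Fin (n + 1) → A,
        ∑ a, f ((Fin.consEquiv fun _ => A) (a, p) 0) * ∏ k : Fin (n + 1),
          M ((Fin.consEquiv fun _ => A) (a, p) k.castSucc)
            ((Fin.consEquiv fun _ => A) (a, p) k.succ)
          = (f ᵥ* M) (p 0) * ∏ k : Fin n, M (p k.castSucc) (p k.succ) := fun p => by
      simp only [Matrix.vecMul, dotProduct, Finset.sum_mul]
      refine Finset.sum_congr rfl fun a _ => ?_
      rw [Fin.prod_univ_succ]
      simp [Fin.consEquiv, mul_assoc]
    rw [Finset.sum_congr rfl fun p _ => h p, ih, pow_succ', ← Matrix.mulVec_mulVec,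
      Matrix.dotProduct_mulVec f M]

/-- If a discrete-time chain started in `i` leaves `A` almost surely, then the probability
of staying in `A` for `n` steps tends to zero. -/
theorem tendsto_pow_block_mulVec_one {S Ωη : Type*} [Fintype S] [DecidableEq S]
    [MeasurableSpace Ωη] {M : Matrix S S ℝ} {A B : Finset S} (hAB : Disjoint A B) {i : A}
    {P : Measure Ωη} {η : ℕ → Ωη → S} (hη : IsDiscreteMarkovChain M (Pi.single (i : S) 1) P η)
    (hhit : P {ω | hittingTime η B ω < ⊤} = 1) :
    Tendsto (fun n => (block M A A ^ n *ᵥ (1 : A → ℝ)) i) atTop (𝓝 0) := by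
  have := hη.isProbabilityMeasure
  have hset : {ω | hittingTime η B ω < ⊤} = ⋃ n : ℕ, ⋃ b : B, {ω | η n ω = b} := by
    ext ω
    simp [hittingTime, iInf_lt_iff]
  have hmeas : MeasurableSet {ω | hittingTime η B ω < ⊤} := by
    rw [hset]
    exact .iUnion fun n => .iUnion fun b => hη.measurable n b
  have hnull := (prob_compl_eq_zero_iff hmeas).2 hhit
  -- The event of staying in `A` through time `n`, written as a disjoint union over paths so that
  -- `finite_dim` computes its probability.
  let s : ℕ → Set Ωη := fun n => ⋃ p : Fin (n + 1) → A, {ω | ∀ k : Fin (n + 1), η k ω = p k}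
  have hs : ∀ n ω, ω ∈ s n ↔ ∀ k, k ≤ n → η k ω ∈ A := fun n ω => by
    simp only [s, Set.mem_iUnion, Set.mem_ofPred_eq]
    refine ⟨fun ⟨p, hp⟩ k hk => ?_, fun h => ⟨fun k => ⟨η k ω, h k (Nat.le_of_lt_succ k.2)⟩,
      fun k => rfl⟩⟩
    have := hp ⟨k, Nat.lt_succ_of_le hk⟩
    simp only at this
    rw [this]
    exact (p _).2
  have hpath : ∀ (n : ℕ) (p : Fin (n + 1) → A),
      MeasurableSet {ω | ∀ k : Fin (n + 1), η k ω = p k} := fun n p => by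
    rw [Set.ofPred_forall]
    exact .iInter fun k => hη.measurable k _
  have hval : ∀ n, P.real (s n) = (block M A A ^ n *ᵥ (1 : A → ℝ)) i := fun n => by
    rw [measureReal_iUnion_fintype _ (hpath n)]
    · have h1 : ∀ p : Fin (n + 1) → A, P.real {ω | ∀ k : Fin (n + 1), η k ω = p k}
          = (Pi.single i 1 : A → ℝ) (p 0)
            * ∏ k : Fin n, block M A A (p k.castSucc) (p k.succ) := fun p => by
        rw [hη.finite_dim n fun k => (p k : S)]
        simp [block, Pi.single_apply]
      rw [Finset.sum_congr rfl fun p _ => h1 p, sum_path_prod_eq_dotProduct_pow]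
      simp
    · intro p q hpq
      refine Set.disjoint_left.2 fun ω hp hq => hpq (funext fun k => Subtype.ext ?_)
      rw [← hp k, ← hq k]
  have hanti : Antitone s := fun m n hmn ω hω =>
    (hs m ω).2 fun k hk => (hs n ω).1 hω k (hk.trans hmn)
  have hlim := tendsto_measure_iInter_atTop (μ := P) (s := s)
    (fun n => (MeasurableSet.iUnion (hpath n)).nullMeasurableSet) hanti ⟨0, measure_ne_top _ _⟩
  have hzero : P (⋂ n, s n) = 0 := by
    refine measure_mono_null ?_ hnull
    intro ω hω hω'
    rw [hset] at hω'
    simp only [Set.mem_iUnion, Set.mem_ofPred_eq] at hω'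
    obtain ⟨n, b, hb⟩ := hω'
    have := (hs n ω).1 (Set.mem_iInter.1 hω n) n le_rfl
    rw [hb] at this
    exact Finset.disjoint_left.1 hAB this b.2
  rw [hzero] at hlim
  have := (ENNReal.tendsto_toReal ENNReal.zero_ne_top).comp hlim
  rw [ENNReal.toReal_zero] at this
  exact this.congr hval

variable {A : Type*} [Fintype A] [DecidableEq A] {W : Matrix A A ℝ}

theorem tendsto_pow_mulVec (hW : ∀ i j, 0 ≤ W i j)
    (hlim : ∀ i, Tendsto (fun n => (W ^ n *ᵥ (1 : A → ℝ)) i) atTop (𝓝 0)) (x : A → ℝ) (i : A) :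
    Tendsto (fun n => (W ^ n *ᵥ x) i) atTop (𝓝 0) := by
  refine squeeze_zero_norm (fun n => ?_) (by simpa using (hlim i).mul_const ‖x‖)
  rw [Real.norm_eq_abs]
  simp only [Matrix.mulVec, dotProduct, Finset.sum_mul]
  refine (Finset.abs_sum_le_sum_abs _ _).trans (Finset.sum_le_sum fun j _ => ?_)
  rw [abs_mul, abs_of_nonneg (pow_apply_nonneg hW n i j), Pi.one_apply, mul_one]
  exact mul_le_mul_of_nonneg_left (norm_le_pi_norm x j) (pow_apply_nonneg hW n i j)

/-- A kernel vector of `1 - W` is fixed by every power of `W`, and these powers tend to zero. -/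
theorem isUnit_one_sub_of_tendsto (hW : ∀ i j, 0 ≤ W i j)
    (hlim : ∀ i, Tendsto (fun n => (W ^ n *ᵥ (1 : A → ℝ)) i) atTop (𝓝 0)) : IsUnit (1 - W) := by
  rw [← Matrix.mulVec_injective_iff_isUnit]
  refine (injective_iff_map_eq_zero (Matrix.mulVecLin (1 - W))).2 fun x hx => ?_
  have hfix : W *ᵥ x = x := by
    rw [Matrix.mulVecLin_apply, Matrix.sub_mulVec, Matrix.one_mulVec] at hx
    exact (sub_eq_zero.1 hx).symm
  have hpow : ∀ n, W ^ n *ᵥ x = x := fun n => by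
    induction n with
    | zero => simp
    | succ n ih => rw [pow_succ, ← Matrix.mulVec_mulVec, hfix, ih]
  ext i
  have := tendsto_pow_mulVec hW hlim x i
  simp only [hpow] at this
  exact tendsto_nhds_unique tendsto_const_nhds this

/-- The solution of `x = y + W x` satisfies `W ^ n x ≤ x` for all `n`; the left side tends to zero.
-/
theorem inv_one_sub_mulVec_nonneg (hW : ∀ i j, 0 ≤ W i j)
    (hlim : ∀ i, Tendsto (fun n => (W ^ n *ᵥ (1 : A → ℝ)) i) atTop (𝓝 0)) {y : A → ℝ}
    (hy : ∀ i, 0 ≤ y i) (i : A) : 0 ≤ ((1 - W)⁻¹ *ᵥ y) i := by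
  set x := (1 - W)⁻¹ *ᵥ y
  have hx : x = y + W *ᵥ x := by
    have : (1 - W) *ᵥ x = y := by
      rw [Matrix.mulVec_mulVec, Matrix.mul_nonsing_inv _
        ((Matrix.isUnit_iff_isUnit_det _).1 (isUnit_one_sub_of_tendsto hW hlim)),
        Matrix.one_mulVec]
    rw [Matrix.sub_mulVec, Matrix.one_mulVec] at this
    rw [← this, sub_add_cancel]
  have hpow : ∀ n i, (W ^ n *ᵥ x) i ≤ x i := fun n => by
    induction n with
    | zero => simp
    | succ n ih =>
      intro i
      have h1 : (W ^ n *ᵥ (W *ᵥ x)) i ≤ (W ^ n *ᵥ x) i := by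
        nth_rewrite 2 [hx]
        rw [Matrix.mulVec_add]
        exact le_add_of_nonneg_left (Finset.sum_nonneg fun j _ =>
          mul_nonneg (pow_apply_nonneg hW n i j) (hy j))
      rw [pow_succ, ← Matrix.mulVec_mulVec]
      exact h1.trans (ih i)
  exact le_of_tendsto' (tendsto_pow_mulVec hW hlim x i) fun n => hpow n i

end Absorption

/-! ### Entrywise limits of rates and jump probabilities. -/

section Limits

variable {S : Type*} [Fintype S] {Q : ℝ → Matrix S S ℝ}

theorem IsRateMatrix.exitRate_eq_sum [DecidableEq S] {G : Matrix S S ℝ} (hG : IsRateMatrix G)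
    (i : S) : exitRate G i = ∑ j ∈ Finset.univ.erase i, G i j := by
  have := hG.row_sum i
  rw [← Finset.add_sum_erase _ _ (Finset.mem_univ i)] at this
  unfold exitRate
  linarith

theorem IsRateMatrix.le_exitRate {G : Matrix S S ℝ} (hG : IsRateMatrix G) {i j : S}
    (hij : i ≠ j) : G i j ≤ exitRate G i := by
  classical
  rw [hG.exitRate_eq_sum i]
  exact Finset.single_le_sum (f := fun j => G i j)
    (fun k hk => hG.nonneg i k (Finset.ne_of_mem_erase hk).symm)
    (Finset.mem_erase.2 ⟨hij.symm, Finset.mem_univ _⟩)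

theorem disjoint_fast_slow (Q : ℝ → Matrix S S ℝ) : Disjoint (fast Q) (slow Q) := by
  refine Finset.disjoint_left.2 fun i hA hB => ?_
  simp only [fast, slow, Finset.mem_filter, Finset.mem_univ, true_and] at hA hB
  obtain ⟨l, hl⟩ := hB
  exact not_tendsto_nhds_of_tendsto_atTop hA l hl

/-- One diverging off-diagonal rate forces the exit rate to diverge; otherwise the exit rate is a
finite sum of convergent rates. -/
theorem mem_fast_or_mem_slow (hrate : ∀ lam, 0 < lam → IsRateMatrix (Q lam))
    (hlim : ∀ i j, i ≠ j → (∃ l : ℝ, Tendsto (fun lam => Q lam i j) atTop (𝓝 l)) ∨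
      Tendsto (fun lam => Q lam i j) atTop atTop) (i : S) : i ∈ fast Q ∨ i ∈ slow Q := by
  classical
  simp only [fast, slow, Finset.mem_filter, Finset.mem_univ, true_and]
  by_cases h : ∃ j, i ≠ j ∧ Tendsto (fun lam => Q lam i j) atTop atTop
  · obtain ⟨j, hij, hj⟩ := h
    refine Or.inl (tendsto_atTop_mono' _ ?_ hj)
    filter_upwards [eventually_gt_atTop 0] with lam hlam
    exact (hrate lam hlam).le_exitRate hij
  · push Not at h
    have hex : ∀ j, ∃ l : ℝ, i ≠ j → Tendsto (fun lam => Q lam i j) atTop (𝓝 l) := fun j => by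
      by_cases hij : i = j
      · exact ⟨0, fun h' => absurd hij h'⟩
      · obtain ⟨l, hl⟩ := (hlim i j hij).resolve_right (h j hij)
        exact ⟨l, fun _ => hl⟩
    choose l hl using hex
    refine Or.inr ⟨∑ j ∈ Finset.univ.erase i, l j, Tendsto.congr' ?_ (tendsto_finsetSum _
      fun j hj => hl j (Finset.ne_of_mem_erase hj).symm)⟩
    filter_upwards [eventually_gt_atTop 0] with lam hlam
    exact ((hrate lam hlam).exitRate_eq_sum i).symm

/-- Off-diagonal rates are dominated by the exit rate, so no entry of a slow row diverges and
`limUnder` is a genuine limit there. -/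
theorem tendsto_limitMatrix_of_mem_slow (hrate : ∀ lam, 0 < lam → IsRateMatrix (Q lam))
    (hlim : ∀ i j, i ≠ j → (∃ l : ℝ, Tendsto (fun lam => Q lam i j) atTop (𝓝 l)) ∨
      Tendsto (fun lam => Q lam i j) atTop atTop) {i : S} (hi : i ∈ slow Q) (j : S) :
    Tendsto (fun lam => Q lam i j) atTop (𝓝 (limitMatrix Q i j)) := by
  refine tendsto_nhds_limUnder ?_
  simp only [slow, Finset.mem_filter, Finset.mem_univ, true_and] at hi
  obtain ⟨l, hl⟩ := hi
  rcases eq_or_ne i j with rfl | hij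
  · exact ⟨-l, by simpa [exitRate] using hl.neg⟩
  · refine (hlim i j hij).resolve_right fun h => ?_
    refine not_tendsto_nhds_of_tendsto_atTop (tendsto_atTop_mono' _ ?_ h) l hl
    filter_upwards [eventually_gt_atTop 0] with lam hlam
    exact (hrate lam hlam).le_exitRate hij

variable [DecidableEq S]

theorem tendsto_limitJump (hjump : ∀ i j, i ≠ j →
      ∃ l : ℝ, Tendsto (fun lam => jumpMatrix (Q lam) i j) atTop (𝓝 l)) (i j : S) :
    Tendsto (fun lam => jumpMatrix (Q lam) i j) atTop (𝓝 (limitJump Q i j)) := by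
  refine tendsto_nhds_limUnder ?_
  rcases eq_or_ne i j with rfl | hij
  · exact ⟨0, by simp [jumpMatrix]⟩
  · exact hjump i j hij

theorem exitRate_mul_one_sub_jumpMatrix {G : Matrix S S ℝ} {i : S} (hi : exitRate G i ≠ 0)
    (j : S) : exitRate G i * ((1 : Matrix S S ℝ) i j - jumpMatrix G i j) = -G i j := by
  rcases eq_or_ne i j with rfl | hij
  · simp [jumpMatrix, exitRate]
  · simp only [jumpMatrix, Matrix.of_apply, if_neg hij, Matrix.one_apply_ne hij]
    field_simp
    ring

theorem sum_jumpMatrix {G : Matrix S S ℝ} (hG : IsRateMatrix G) {i : S} (hi : exitRate G i ≠ 0) :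
    ∑ j, jumpMatrix G i j = 1 := by
  have h : ∑ j, exitRate G i * ((1 : Matrix S S ℝ) i j - jumpMatrix G i j) = 0 := by
    rw [Finset.sum_congr rfl fun j _ => exitRate_mul_one_sub_jumpMatrix hi j,
      Finset.sum_neg_distrib, hG.row_sum, neg_zero]
  rw [← Finset.mul_sum, mul_eq_zero, or_iff_right hi, Finset.sum_sub_distrib] at h
  simp [Matrix.one_apply] at h
  linarith

theorem jumpMatrix_nonneg {G : Matrix S S ℝ} (hG : IsRateMatrix G) (i j : S) :
    0 ≤ jumpMatrix G i j := by
  rcases eq_or_ne i j with rfl | hij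
  · simp [jumpMatrix]
  · simp only [jumpMatrix, Matrix.of_apply, if_neg hij]
    exact div_nonneg (hG.nonneg i j hij) ((hG.nonneg i j hij).trans (hG.le_exitRate hij))

theorem limitJump_nonneg (hrate : ∀ lam, 0 < lam → IsRateMatrix (Q lam))
    (hjump : ∀ i j, i ≠ j →
      ∃ l : ℝ, Tendsto (fun lam => jumpMatrix (Q lam) i j) atTop (𝓝 l)) (i j : S) :
    0 ≤ limitJump Q i j := by
  refine ge_of_tendsto (tendsto_limitJump hjump i j) ?_
  filter_upwards [eventually_gt_atTop 0] with lam hlam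
  exact jumpMatrix_nonneg (hrate lam hlam) i j

theorem eventually_exitRate_pos {i : S} (hi : i ∈ fast Q) :
    ∀ᶠ lam in atTop, 0 < exitRate (Q lam) i := by
  simp only [fast, Finset.mem_filter, Finset.mem_univ, true_and] at hi
  exact hi.eventually (eventually_gt_atTop 0)

theorem sum_limitJump (hrate : ∀ lam, 0 < lam → IsRateMatrix (Q lam))
    (hjump : ∀ i j, i ≠ j →
      ∃ l : ℝ, Tendsto (fun lam => jumpMatrix (Q lam) i j) atTop (𝓝 l)) {i : S}
    (hi : i ∈ fast Q) : ∑ j, limitJump Q i j = 1 := by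
  refine tendsto_nhds_unique (tendsto_finsetSum _ fun j _ => tendsto_limitJump hjump i j) ?_
  refine tendsto_const_nhds.congr' ?_
  filter_upwards [eventually_gt_atTop 0, eventually_exitRate_pos hi] with lam hlam hpos
  exact (sum_jumpMatrix (hrate lam hlam) hpos.ne').symm

theorem sum_limitMatrix (hrate : ∀ lam, 0 < lam → IsRateMatrix (Q lam))
    (hlim : ∀ i j, i ≠ j → (∃ l : ℝ, Tendsto (fun lam => Q lam i j) atTop (𝓝 l)) ∨
      Tendsto (fun lam => Q lam i j) atTop atTop) {i : S} (hi : i ∈ slow Q) :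
    ∑ j, limitMatrix Q i j = 0 := by
  refine tendsto_nhds_unique (tendsto_finsetSum _ fun j _ =>
    tendsto_limitMatrix_of_mem_slow hrate hlim hi j) (tendsto_const_nhds.congr' ?_)
  filter_upwards [eventually_gt_atTop 0] with lam hlam
  exact ((hrate lam hlam).row_sum i).symm

theorem limitMatrix_nonneg (hrate : ∀ lam, 0 < lam → IsRateMatrix (Q lam))
    (hlim : ∀ i j, i ≠ j → (∃ l : ℝ, Tendsto (fun lam => Q lam i j) atTop (𝓝 l)) ∨
      Tendsto (fun lam => Q lam i j) atTop atTop) {i : S} (hi : i ∈ slow Q) {j : S}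
    (hij : i ≠ j) : 0 ≤ limitMatrix Q i j := by
  refine ge_of_tendsto (tendsto_limitMatrix_of_mem_slow hrate hlim hi j) ?_
  filter_upwards [eventually_gt_atTop 0] with lam hlam
  exact (hrate lam hlam).nonneg i j hij

theorem tendsto_block {M : ℝ → Matrix S S ℝ} {L : Matrix S S ℝ} {U V : Finset S}
    (h : ∀ i ∈ U, ∀ j, Tendsto (fun lam => M lam i j) atTop (𝓝 (L i j))) :
    Tendsto (fun lam => block (M lam) U V) atTop (𝓝 (block L U V)) :=
  tendsto_pi_nhds.2 fun i => tendsto_pi_nhds.2 fun j => h i i.2 j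

theorem sum_eq_sum_fast_add_sum_slow (hcover : ∀ i, i ∈ fast Q ∨ i ∈ slow Q) (f : S → ℝ) :
    ∑ i, f i = ∑ i : fast Q, f i + ∑ i : slow Q, f i := by
  have h : (Finset.univ : Finset S) = fast Q ∪ slow Q := by
    ext i
    simp [hcover i]
  rw [h, Finset.sum_union (disjoint_fast_slow Q), Finset.sum_coe_sort (fast Q),
    Finset.sum_coe_sort (slow Q)]

theorem tendsto_matrix_inv {m : Type*} [Fintype m] [DecidableEq m] {M : ℝ → Matrix m m ℝ}
    {L : Matrix m m ℝ} (hL : IsUnit L) (h : Tendsto M atTop (𝓝 L)) :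
    Tendsto (fun lam => (M lam)⁻¹) atTop (𝓝 L⁻¹) := by
  obtain ⟨u, rfl⟩ := hL
  simp only [Matrix.nonsing_inv_eq_ringInverse]
  exact (NormedRing.inverse_continuousAt u).tendsto.comp h

end Limits

/-! ### Construction of the correctors. -/

section Correctors

variable {S : Type*} [Fintype S] [DecidableEq S] {Q : ℝ → Matrix S S ℝ}

theorem tendsto_matrix_mul {l m n : Type*} [Fintype l] [Fintype m] [Fintype n]
    {U : ℝ → Matrix l m ℝ} {V : ℝ → Matrix m n ℝ} {U' : Matrix l m ℝ} {V' : Matrix m n ℝ}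
    (hU : Tendsto U atTop (𝓝 U')) (hV : Tendsto V atTop (𝓝 V')) :
    Tendsto (fun lam => U lam * V lam) atTop (𝓝 (U' * V')) :=
  ((continuous_fst.matrix_mul continuous_snd).tendsto (U', V')).comp (hU.prodMk_nhds hV)

theorem tendsto_matrix_apply {m n : Type*} [Fintype m] [Fintype n] {U : ℝ → Matrix m n ℝ}
    {U' : Matrix m n ℝ} (hU : Tendsto U atTop (𝓝 U')) (i : m) (j : n) :
    Tendsto (fun lam => U lam i j) atTop (𝓝 (U' i j)) :=
  ((continuous_id.matrix_elem i j).tendsto U').comp hU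

/-- The matrix on `S × B` with block `P` on the fast rows and the identity on the slow rows. -/
def extendRows (Q : ℝ → Matrix S S ℝ) (P : Matrix (fast Q) (slow Q) ℝ) : Matrix S (slow Q) ℝ :=
  Matrix.of fun i b => if h : i ∈ fast Q then P ⟨i, h⟩ b else (1 : Matrix S S ℝ) i b

/-- Restriction of functions on `S` to the slow states. -/
def slowRestriction (Q : ℝ → Matrix S S ℝ) : Matrix (slow Q) S ℝ :=
  (1 : Matrix S S ℝ).submatrix (fun b => (b : S)) id

theorem extendRows_fast (P : Matrix (fast Q) (slow Q) ℝ) (i : fast Q) (b : slow Q) :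
    extendRows Q P i b = P i b := by
  simp [extendRows]

theorem extendRows_slow (P : Matrix (fast Q) (slow Q) ℝ) {i : S} (hi : i ∈ slow Q)
    (b : slow Q) : extendRows Q P i b = (1 : Matrix S S ℝ) i b := by
  have : i ∉ fast Q := fun h => Finset.disjoint_left.1 (disjoint_fast_slow Q) h hi
  simp [extendRows, this]

/-- For `P = passage Q` and `x = π` this is `γ(π) = π K`; with `x` a row of a matrix it gives
`mul_extendRows`. -/
theorem vecMul_extendRows
    (hcover : ∀ i, i ∈ fast Q ∨ i ∈ slow Q)
    (x : S → ℝ) (P : Matrix (fast Q) (slow Q) ℝ) (b : slow Q) :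
    (x ᵥ* extendRows Q P) b = ((fun i : fast Q => x i) ᵥ* P) b + x b := by
  simp only [Matrix.vecMul, dotProduct]
  rw [sum_eq_sum_fast_add_sum_slow hcover]
  congr 1
  · exact Finset.sum_congr rfl fun a _ => by rw [extendRows_fast]
  · rw [Finset.sum_congr rfl fun (c : slow Q) _ => by rw [extendRows_slow P c.2 b]]
    simp [Matrix.one_apply]

theorem mul_extendRows
    (hcover : ∀ i, i ∈ fast Q ∨ i ∈ slow Q)
    (G : Matrix S S ℝ) (P : Matrix (fast Q) (slow Q) ℝ) (i : S) (b : slow Q) :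
    (G * extendRows Q P) i b = ∑ a : fast Q, G i a * P a b + G i b :=
  vecMul_extendRows hcover (G i) P b

theorem extendRows_mul_slow (P : Matrix (fast Q) (slow Q) ℝ) {n : Type*}
    (M : Matrix (slow Q) n ℝ) (i : slow Q) (b : n) : (extendRows Q P * M) i b = M i b := by
  rw [Matrix.mul_apply, Finset.sum_congr rfl fun (c : slow Q) _ => by rw [extendRows_slow P i.2 c]]
  simp [Matrix.one_apply]

theorem extendRows_mul_fast (P : Matrix (fast Q) (slow Q) ℝ) {n : Type*}
    (M : Matrix (slow Q) n ℝ) (i : fast Q) (b : n) :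
    (extendRows Q P * M) i b = (P * M) i b := by
  simp only [Matrix.mul_apply, extendRows_fast]

theorem tendsto_extendRows
    (hcover : ∀ i, i ∈ fast Q ∨ i ∈ slow Q)
    {P : ℝ → Matrix (fast Q) (slow Q) ℝ} {P' : Matrix (fast Q) (slow Q) ℝ}
    (hP : Tendsto P atTop (𝓝 P')) :
    Tendsto (fun lam => extendRows Q (P lam)) atTop (𝓝 (extendRows Q P')) := by
  refine tendsto_pi_nhds.2 fun i => tendsto_pi_nhds.2 fun b => ?_
  rcases hcover i with hi | hi
  · simpa only [extendRows_fast _ (⟨i, hi⟩ : fast Q)] using tendsto_matrix_apply hP ⟨i, hi⟩ b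
  · simp only [extendRows_slow _ hi]
    exact tendsto_const_nhds

theorem diagonal_mul_one_sub_extendRows_mul
    (hcover : ∀ i, i ∈ fast Q ∨ i ∈ slow Q)
    (P : Matrix (fast Q) (slow Q) ℝ) :
    Matrix.diagonal (fun i => if i ∈ fast Q then (1 : ℝ) else 0)
        * (1 - extendRows Q P * slowRestriction Q) = 1 - extendRows Q P * slowRestriction Q := by
  ext i j
  rw [Matrix.diagonal_mul]
  rcases hcover i with hi | hi
  · rw [if_pos hi, one_mul]
  · have h := extendRows_mul_slow P (slowRestriction Q) ⟨i, hi⟩ j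
    have h0 : (1 - extendRows Q P * slowRestriction Q : Matrix S S ℝ) i j = 0 := by
      rw [Matrix.sub_apply, h]
      exact sub_self _
    rw [h0, mul_zero]

/-- Only an upper bound is possible: on a fast row the value is minus the rate into `B`, which may
diverge to `-∞`, while on a slow row it converges. -/
theorem exists_eventually_mulVec_indicator_le
    (hcover : ∀ i, i ∈ fast Q ∨ i ∈ slow Q)
    (hrate : ∀ lam, 0 < lam → IsRateMatrix (Q lam))
    (hlim : ∀ i j, i ≠ j → (∃ l : ℝ, Tendsto (fun lam => Q lam i j) atTop (𝓝 l)) ∨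
      Tendsto (fun lam => Q lam i j) atTop atTop) :
    ∃ C : ℝ, 0 ≤ C ∧ ∀ᶠ lam in atTop, ∀ i,
      (Q lam *ᵥ fun i => if i ∈ fast Q then (1 : ℝ) else 0) i ≤ C := by
  have hval : ∀ lam i, (Q lam *ᵥ fun i => if i ∈ fast Q then (1 : ℝ) else 0) i
      = ∑ a : fast Q, Q lam i a := fun lam i => by
    simp only [Matrix.mulVec, dotProduct]
    rw [sum_eq_sum_fast_add_sum_slow hcover]
    have h2 : ∑ b : slow Q, Q lam i b * (if (b : S) ∈ fast Q then (1 : ℝ) else 0) = 0 :=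
      Finset.sum_eq_zero fun b _ => by
        rw [if_neg (Finset.disjoint_right.1 (disjoint_fast_slow Q) b.2), mul_zero]
    rw [h2, add_zero]
    exact Finset.sum_congr rfl fun a _ => by rw [if_pos a.2, mul_one]
  set L : S → ℝ := fun i => ∑ a : fast Q, limitMatrix Q i a
  have hnn : 0 ≤ ∑ i, |L i| := Finset.sum_nonneg fun _ _ => abs_nonneg _
  refine ⟨∑ i, |L i| + 1, by positivity, eventually_all.2 fun i => ?_⟩
  rcases hcover i with hi | hi
  · filter_upwards [eventually_gt_atTop 0] with lam hlam
    have h1 := (hrate lam hlam).row_sum i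
    rw [sum_eq_sum_fast_add_sum_slow hcover] at h1
    have h2 : 0 ≤ ∑ b : slow Q, Q lam i b := Finset.sum_nonneg fun b _ =>
      (hrate lam hlam).nonneg i b fun hib =>
        Finset.disjoint_left.1 (disjoint_fast_slow Q) hi (hib ▸ b.2)
    rw [hval]
    linarith
  · have h1 : Tendsto (fun lam => ∑ a : fast Q, Q lam i a) atTop (𝓝 (L i)) :=
      tendsto_finsetSum _ fun a _ => tendsto_limitMatrix_of_mem_slow hrate hlim hi a
    have h2 : L i < ∑ i, |L i| + 1 := by
      have h3 : |L i| ≤ ∑ i, |L i| := Finset.single_le_sum (f := fun i => |L i|)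
        (fun i _ => abs_nonneg _) (Finset.mem_univ i)
      linarith [le_abs_self (L i)]
    filter_upwards [h1.eventually (gt_mem_nhds h2)] with lam hl
    rw [hval]
    exact hl.le

/-- Fast rows of `Ω` sum to one, so `Ω_AB 1 = (I - Ω_AA) 1`. -/
theorem passage_mulVec_one
    (hcover : ∀ i, i ∈ fast Q ∨ i ∈ slow Q)
    (hrate : ∀ lam, 0 < lam → IsRateMatrix (Q lam))
    (hjump : ∀ i j, i ≠ j →
      ∃ l : ℝ, Tendsto (fun lam => jumpMatrix (Q lam) i j) atTop (𝓝 l))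
    (hunit : IsUnit (1 - block (limitJump Q) (fast Q) (fast Q)))
    : passage Q *ᵥ (1 : slow Q → ℝ) = 1 := by
  have h : block (limitJump Q) (fast Q) (slow Q) *ᵥ (1 : slow Q → ℝ)
      = (1 - block (limitJump Q) (fast Q) (fast Q)) *ᵥ (1 : fast Q → ℝ) := by
    ext i
    have h1 := sum_limitJump hrate hjump i.2
    rw [sum_eq_sum_fast_add_sum_slow hcover] at h1
    rw [Matrix.sub_mulVec, Matrix.one_mulVec]
    simp only [Matrix.mulVec, dotProduct, block, Matrix.submatrix_apply, Pi.one_apply, mul_one,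
      Pi.sub_apply]
    linarith
  rw [passage, ← Matrix.mulVec_mulVec, h, Matrix.mulVec_mulVec,
    Matrix.nonsing_inv_mul _ ((Matrix.isUnit_iff_isUnit_det _).1 hunit), Matrix.one_mulVec]

theorem extendRows_passage_mulVec_one
    (hcover : ∀ i, i ∈ fast Q ∨ i ∈ slow Q)
    (hrate : ∀ lam, 0 < lam → IsRateMatrix (Q lam))
    (hjump : ∀ i j, i ≠ j →
      ∃ l : ℝ, Tendsto (fun lam => jumpMatrix (Q lam) i j) atTop (𝓝 l))
    (hunit : IsUnit (1 - block (limitJump Q) (fast Q) (fast Q))) :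
    extendRows Q (passage Q) *ᵥ (1 : slow Q → ℝ) = 1 := by
  ext i
  rcases hcover i with hi | hi
  · refine Eq.trans ?_ (congrFun (passage_mulVec_one hcover hrate hjump hunit) ⟨i, hi⟩)
    simp only [Matrix.mulVec, dotProduct, extendRows_fast _ (⟨i, hi⟩ : fast Q)]
  · simp only [Matrix.mulVec, dotProduct, extendRows_slow _ hi]
    have := Finset.sum_ite_eq' Finset.univ (⟨i, hi⟩ : slow Q) fun _ => (1 : ℝ)
    simpa [Matrix.one_apply, Subtype.ext_iff, eq_comm] using this

theorem reducedRate_isRateMatrix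
    (hcover : ∀ i, i ∈ fast Q ∨ i ∈ slow Q)
    (hrate : ∀ lam, 0 < lam → IsRateMatrix (Q lam))
    (hlim : ∀ i j, i ≠ j → (∃ l : ℝ, Tendsto (fun lam => Q lam i j) atTop (𝓝 l)) ∨
      Tendsto (fun lam => Q lam i j) atTop atTop)
    (hjump : ∀ i j, i ≠ j →
      ∃ l : ℝ, Tendsto (fun lam => jumpMatrix (Q lam) i j) atTop (𝓝 l))
    (hunit : IsUnit (1 - block (limitJump Q) (fast Q) (fast Q)))
    (hpass : ∀ i j, 0 ≤ passage Q i j) :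
    IsRateMatrix (reducedRate Q) where
  nonneg i j hij := by
    refine add_nonneg (limitMatrix_nonneg hrate hlim i.2 fun h => hij (Subtype.ext h)) ?_
    rw [Matrix.mul_apply]
    exact Finset.sum_nonneg fun a _ => mul_nonneg (limitMatrix_nonneg hrate hlim i.2 fun h =>
      Finset.disjoint_right.1 (disjoint_fast_slow Q) i.2 (h ▸ a.2)) (hpass a j)
  row_sum i := by
    have h : (reducedRate Q *ᵥ (1 : slow Q → ℝ)) i = 0 := by
      rw [reducedRate, Matrix.add_mulVec, ← Matrix.mulVec_mulVec,
        passage_mulVec_one hcover hrate hjump hunit]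
      have h1 := sum_limitMatrix hrate hlim i.2
      rw [sum_eq_sum_fast_add_sum_slow hcover] at h1
      simp only [Matrix.mulVec, dotProduct, block, Matrix.submatrix_apply, Pi.one_apply, mul_one,
        Pi.add_apply]
      linarith
    simpa [Matrix.mulVec, dotProduct] using h

/-- Existence of the correctors: an approximate intertwiner of `Q(lam)` and the reduced rate
matrix, and a Lyapunov function for the time spent in the fast states. -/
theorem exists_correctors
    (hcover : ∀ i, i ∈ fast Q ∨ i ∈ slow Q)
    (hrate : ∀ lam, 0 < lam → IsRateMatrix (Q lam))
    (hlim : ∀ i j, i ≠ j → (∃ l : ℝ, Tendsto (fun lam => Q lam i j) atTop (𝓝 l)) ∨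
      Tendsto (fun lam => Q lam i j) atTop atTop)
    (hjump : ∀ i j, i ≠ j →
      ∃ l : ℝ, Tendsto (fun lam => jumpMatrix (Q lam) i j) atTop (𝓝 l))
    (hunit : IsUnit (1 - block (limitJump Q) (fast Q) (fast Q))) :
    ∃ (P : ℝ → Matrix (fast Q) (slow Q) ℝ) (v : ℝ → S → ℝ),
      Tendsto P atTop (𝓝 (passage Q)) ∧
      Tendsto (fun lam => Q lam * extendRows Q (P lam) - extendRows Q (P lam) * reducedRate Q)
        atTop (𝓝 0) ∧
      Tendsto v atTop (𝓝 0) ∧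
      Tendsto (fun lam => Q lam *ᵥ v lam + fun i => if i ∈ fast Q then (1 : ℝ) else 0)
        atTop (𝓝 0) := by
  let W : ℝ → Matrix (fast Q) (fast Q) ℝ := fun lam =>
    1 - block (jumpMatrix (Q lam)) (fast Q) (fast Q)
  let D : ℝ → Matrix (fast Q) (fast Q) ℝ := fun lam =>
    Matrix.diagonal fun a => (exitRate (Q lam) a)⁻¹
  -- For large `lam`, `Q_AA = -diag(q) W`, so `N = -Q_AA⁻¹` and `P₀ = -Q_AA⁻¹ Q_AB`. Written through
  -- the jump matrix, both have visible limits.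
  let N : ℝ → Matrix (fast Q) (fast Q) ℝ := fun lam => (W lam)⁻¹ * D lam
  let P₀ : ℝ → Matrix (fast Q) (slow Q) ℝ := fun lam =>
    (W lam)⁻¹ * block (jumpMatrix (Q lam)) (fast Q) (slow Q)
  have hW : Tendsto W atTop (𝓝 (1 - block (limitJump Q) (fast Q) (fast Q))) :=
    tendsto_const_nhds.sub (tendsto_block fun i _ j => tendsto_limitJump hjump i j)
  have hWinv := tendsto_matrix_inv hunit hW
  have hD : Tendsto D atTop (𝓝 0) := by
    refine tendsto_pi_nhds.2 fun i => tendsto_pi_nhds.2 fun j => ?_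
    rcases eq_or_ne i j with rfl | hij
    · have hi := i.2
      simp only [fast, Finset.mem_filter, Finset.mem_univ, true_and] at hi
      simpa [D, Matrix.diagonal_apply_eq, Function.comp_def] using tendsto_inv_atTop_zero.comp hi
    · simp [D, Matrix.diagonal_apply_ne _ hij]
  have hN : Tendsto N atTop (𝓝 0) := by
    simpa using tendsto_matrix_mul hWinv hD
  have hP₀ : Tendsto P₀ atTop (𝓝 (passage Q)) :=
    tendsto_matrix_mul hWinv (tendsto_block fun i _ j => tendsto_limitJump hjump i j)
  have hev : ∀ᶠ lam in atTop, block (Q lam) (fast Q) (fast Q) * P₀ lam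
      = -block (Q lam) (fast Q) (slow Q) ∧ block (Q lam) (fast Q) (fast Q) * N lam = -1 := by
    have hdet : ∀ᶠ lam in atTop, IsUnit (W lam).det := by
      have h0 := ((Matrix.isUnit_iff_isUnit_det _).1 hunit).ne_zero
      have hc : Continuous fun M : Matrix (fast Q) (fast Q) ℝ => M.det :=
        continuous_id.matrix_det
      filter_upwards [((hc.tendsto _).comp hW).eventually (isOpen_ne.mem_nhds h0)] with lam h
      exact isUnit_iff_ne_zero.2 h
    have hpos : ∀ᶠ lam in atTop, ∀ a : fast Q, 0 < exitRate (Q lam) a :=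
      eventually_all.2 fun a => eventually_exitRate_pos a.2
    filter_upwards [hdet, hpos] with lam hd hp
    set q : fast Q → ℝ := fun a => exitRate (Q lam) a
    have hAA : block (Q lam) (fast Q) (fast Q) = -(Matrix.diagonal q * W lam) := by
      ext i j
      have := exitRate_mul_one_sub_jumpMatrix (hp i).ne' (j : S)
      rw [Matrix.neg_apply, Matrix.diagonal_mul]
      change _ = -(exitRate (Q lam) i
        * ((1 : Matrix (fast Q) (fast Q) ℝ) i j - jumpMatrix (Q lam) i j))
      rw [show (1 : Matrix (fast Q) (fast Q) ℝ) i j = (1 : Matrix S S ℝ) i j by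
        simp only [Matrix.one_apply, Subtype.ext_iff], this, neg_neg]
      rfl
    have hAB : Matrix.diagonal q * block (jumpMatrix (Q lam)) (fast Q) (slow Q)
        = block (Q lam) (fast Q) (slow Q) := by
      ext i j
      have hij : (i : S) ≠ j := fun h =>
        Finset.disjoint_left.1 (disjoint_fast_slow Q) i.2 (h ▸ j.2)
      have := exitRate_mul_one_sub_jumpMatrix (hp i).ne' (j : S)
      rw [Matrix.one_apply_ne hij] at this
      rw [Matrix.diagonal_mul]
      change exitRate (Q lam) i * jumpMatrix (Q lam) i j = Q lam i j
      linarith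
    have hqD : Matrix.diagonal q * D lam = 1 := by
      rw [Matrix.diagonal_mul_diagonal, ← Matrix.diagonal_one]
      congr 1
      ext a
      exact mul_inv_cancel₀ (hp a).ne'
    constructor
    · rw [hAA, Matrix.neg_mul, Matrix.mul_assoc, Matrix.mul_nonsing_inv_cancel_left _ _ hd, hAB]
    · rw [hAA, Matrix.neg_mul, Matrix.mul_assoc, Matrix.mul_nonsing_inv_cancel_left _ _ hd, hqD]
  -- `P₀` alone leaves the defect `-P₀ Γ` on the fast rows. Since `Q_AA N = -1`, subtracting `N P₀
  -- Γ` cancels it and leaves `N P₀ Γ²`, which vanishes with `N`.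
  let P : ℝ → Matrix (fast Q) (slow Q) ℝ := fun lam =>
    P₀ lam - N lam * P₀ lam * reducedRate Q
  have hP : Tendsto P atTop (𝓝 (passage Q)) := by
    simpa using hP₀.sub (tendsto_matrix_mul (tendsto_matrix_mul hN hP₀)
      (tendsto_const_nhds (x := reducedRate Q)))
  have hBA : Tendsto (fun lam => block (Q lam) (slow Q) (fast Q)) atTop
      (𝓝 (block (limitMatrix Q) (slow Q) (fast Q))) :=
    tendsto_block fun i hi j => tendsto_limitMatrix_of_mem_slow hrate hlim hi j
  have hBB : Tendsto (fun lam => block (Q lam) (slow Q) (slow Q)) atTop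
      (𝓝 (block (limitMatrix Q) (slow Q) (slow Q))) :=
    tendsto_block fun i hi j => tendsto_limitMatrix_of_mem_slow hrate hlim hi j
  have hNone : Tendsto (fun lam => N lam *ᵥ (1 : fast Q → ℝ)) atTop (𝓝 0) := by
    have hc : Continuous fun M : Matrix (fast Q) (fast Q) ℝ => M *ᵥ (1 : fast Q → ℝ) :=
      continuous_id.matrix_mulVec continuous_const
    simpa [Function.comp_def] using (hc.tendsto 0).comp hN
  -- `N 1 = -Q_AA⁻¹ 1` is the mean time to leave `A`; thus `Q v` is eventually `-1` on `A`, and on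
  -- `B` it is `Q_BA N 1 → 0`.
  let v : ℝ → S → ℝ := fun lam i => if h : i ∈ fast Q then (N lam *ᵥ (1 : fast Q → ℝ)) ⟨i, h⟩ else 0
  have hvmul : ∀ lam i, (Q lam *ᵥ v lam) i
      = ∑ a : fast Q, Q lam i a * (N lam *ᵥ (1 : fast Q → ℝ)) a := fun lam i => by
    change ∑ j, Q lam i j * v lam j = _
    rw [sum_eq_sum_fast_add_sum_slow hcover]
    have h1 : ∑ b : slow Q, Q lam i b * v lam b = 0 := Finset.sum_eq_zero fun b _ => by
      simp only [v, Finset.disjoint_right.1 (disjoint_fast_slow Q) b.2, dite_false, mul_zero]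
    rw [h1, add_zero]
    exact Finset.sum_congr rfl fun a _ => by simp [v]
  refine ⟨P, v, hP, ?_, ?_, ?_⟩
  · refine tendsto_pi_nhds.2 fun i => tendsto_pi_nhds.2 fun b => ?_
    rcases hcover i with hi | hi
    · have h0 : Tendsto (fun lam => N lam * P₀ lam * reducedRate Q * reducedRate Q) atTop
          (𝓝 0) := by
        simpa using tendsto_matrix_mul (tendsto_matrix_mul (tendsto_matrix_mul hN hP₀)
          (tendsto_const_nhds (x := reducedRate Q))) (tendsto_const_nhds (x := reducedRate Q))
      refine (tendsto_matrix_apply h0 ⟨i, hi⟩ b).congr' ?_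
      filter_upwards [hev] with lam ⟨h1, h2⟩
      have h3 : block (Q lam) (fast Q) (fast Q) * P lam + block (Q lam) (fast Q) (slow Q)
          - P lam * reducedRate Q = N lam * P₀ lam * reducedRate Q * reducedRate Q := by
        simp only [P, Matrix.mul_sub, Matrix.sub_mul, ← Matrix.mul_assoc, h1, h2]
        simp
      have h4 : (Q lam * extendRows Q (P lam) - extendRows Q (P lam) * reducedRate Q) i b
          = (block (Q lam) (fast Q) (fast Q) * P lam + block (Q lam) (fast Q) (slow Q)
            - P lam * reducedRate Q) ⟨i, hi⟩ b := by
        rw [Matrix.sub_apply, mul_extendRows hcover,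
          extendRows_mul_fast _ _ (⟨i, hi⟩ : fast Q)]
        rfl
      rw [h4, h3]
    · have h0 : Tendsto (fun lam => block (Q lam) (slow Q) (fast Q) * P lam
          + block (Q lam) (slow Q) (slow Q) - reducedRate Q) atTop (𝓝 0) := by
        have h1 := ((tendsto_matrix_mul hBA hP).add hBB).sub_const (reducedRate Q)
        have h2 : block (limitMatrix Q) (slow Q) (fast Q) * passage Q
            + block (limitMatrix Q) (slow Q) (slow Q) = reducedRate Q := add_comm _ _
        rwa [h2, sub_self] at h1
      refine (tendsto_matrix_apply h0 ⟨i, hi⟩ b).congr fun lam => ?_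
      rw [Matrix.sub_apply (Q lam * _), mul_extendRows hcover,
        extendRows_mul_slow _ _ (⟨i, hi⟩ : slow Q)]
      rfl
  · refine tendsto_pi_nhds.2 fun i => ?_
    by_cases hi : i ∈ fast Q
    · simpa [v, hi] using tendsto_pi_nhds.1 hNone ⟨i, hi⟩
    · simp [v, hi]
  · refine tendsto_pi_nhds.2 fun i => ?_
    simp only [Pi.add_apply, hvmul]
    rcases hcover i with hi | hi
    · refine tendsto_const_nhds.congr' ?_
      filter_upwards [hev] with lam ⟨_, h2⟩
      have h3 := congrFun (congrArg (fun M => M *ᵥ (1 : fast Q → ℝ)) h2) ⟨i, hi⟩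
      simp only [← Matrix.mulVec_mulVec, Matrix.neg_mulVec, Matrix.one_mulVec, Pi.neg_apply,
        Pi.one_apply] at h3
      have h4 : ∑ a : fast Q, Q lam i a * (N lam *ᵥ (1 : fast Q → ℝ)) a = -1 := h3
      rw [h4, if_pos hi]
      simp
    · rw [Pi.zero_apply, if_neg (Finset.disjoint_right.1 (disjoint_fast_slow Q) hi)]
      have := tendsto_finsetSum Finset.univ fun (a : fast Q) _ =>
        (tendsto_limitMatrix_of_mem_slow hrate hlim hi a).mul (tendsto_pi_nhds.1 hNone a)
      simpa using this

end Correctors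

/-! ### Laws of the chains and total variation. -/

theorem IsMarkovChain.law_eq {E Ω : Type*} [Fintype E] [DecidableEq E] [MeasurableSpace Ω]
    {G : Matrix E E ℝ} {π : E → ℝ} {P : Measure Ω} {X : ℝ≥0 → Ω → E}
    (hX : IsMarkovChain G π P X) (t : ℝ≥0) : law P (X t) = π ᵥ* exp ((t : ℝ) • G) := by
  have := hX.isProbabilityMeasure
  ext i
  have hunion : {ω | X t ω = i} = ⋃ j, {ω | X 0 ω = j ∧ X t ω = i} := by
    ext ω
    simp
  have hpair : ∀ j, {ω | X 0 ω = j ∧ X t ω = i}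
      = {ω | ∀ k : Fin 2, X (![0, t] k) ω = ![j, i] k} := fun j => by
    ext ω
    simp [Fin.forall_fin_two]
  have hmono : Monotone ![0, t] := by
    rw [Fin.monotone_iff_le_succ]
    intro k
    fin_cases k
    simp
  rw [law, hunion, measureReal_iUnion_fintype]
  · refine Finset.sum_congr rfl fun j _ => ?_
    rw [hpair, hX.finite_dim 1 ![0, t] ![j, i] hmono rfl]
    simp
  · intro j k hjk
    exact Set.disjoint_left.2 fun ω hj hk => hjk (hj.1.symm.trans hk.1)
  · exact fun j => (hX.measurable 0 j).inter (hX.measurable t i)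

theorem tvDist_vecMul_le {S : Type*} [Fintype S] {π : S → ℝ} (hπ : π ∈ stdSimplex ℝ S)
    (M N : Matrix S S ℝ) : tvDist (π ᵥ* M) (π ᵥ* N) ≤ ‖M - N‖ := by
  have h : ∀ i, |(π ᵥ* M) i - (π ᵥ* N) i| ≤ ∑ j, π j * |(M - N) j i| := fun i => by
    rw [← Pi.sub_apply, ← Matrix.vecMul_sub]
    refine (Finset.abs_sum_le_sum_abs _ _).trans (Finset.sum_le_sum fun j _ => ?_)
    rw [abs_mul, abs_of_nonneg (hπ.1 j)]
  have h2 : ∑ i, |(π ᵥ* M) i - (π ᵥ* N) i| ≤ ‖M - N‖ :=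
    calc ∑ i, |(π ᵥ* M) i - (π ᵥ* N) i| ≤ ∑ i, ∑ j, π j * |(M - N) j i| :=
          Finset.sum_le_sum fun i _ => h i
      _ = ∑ j, π j * ∑ i, |(M - N) j i| := by
          rw [Finset.sum_comm]
          simp only [Finset.mul_sum]
      _ ≤ ∑ j, π j * ‖M - N‖ := Finset.sum_le_sum fun j _ =>
          mul_le_mul_of_nonneg_left (row_abs_sum_le_norm _ j) (hπ.1 j)
      _ = ‖M - N‖ := by rw [← Finset.sum_mul, hπ.2, one_mul]
  have := norm_nonneg (M - N)
  unfold tvDist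
  linarith

theorem law_coe_slow {S Ω : Type*} [Fintype S] [DecidableEq S] [MeasurableSpace Ω]
    {Q : ℝ → Matrix S S ℝ} (P : Measure Ω) (Z : Ω → slow Q) :
    law P (fun ω => (Z ω : S)) = law P Z ᵥ* slowRestriction Q := by
  ext i
  simp only [Matrix.vecMul, dotProduct, slowRestriction, Matrix.submatrix_apply, id_eq,
    Matrix.one_apply, mul_ite, mul_one, mul_zero]
  by_cases hi : i ∈ slow Q
  · rw [Finset.sum_eq_single ⟨i, hi⟩ (fun b _ hb => if_neg fun h => hb (Subtype.ext h))
      (fun h => absurd (Finset.mem_univ _) h), if_pos rfl]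
    simp [law, Subtype.ext_iff]
  · rw [Finset.sum_eq_zero fun (b : slow Q) _ => if_neg fun h : (b : S) = i => hi (h ▸ b.2)]
    have : {ω | (Z ω : S) = i} = ∅ := Set.eq_empty_of_forall_notMem fun ω hω => hi (hω ▸ (Z ω).2)
    rw [law, this, measureReal_empty]

end TwoTimeScale

end

/-! ### The main theorem. -/

theorem theorem6 {S : Type*} [Fintype S] [DecidableEq S]
    -- the transition rate matrices and their standing assumptions
    (Q : ℝ → Matrix S S ℝ)
    (hrate : ∀ lam, 0 < lam → TwoTimeScale.IsRateMatrix (Q lam))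
    (hirr : ∀ lam, 0 < lam → TwoTimeScale.IsIrreducibleRate (Q lam))
    (hlim : ∀ i j, i ≠ j →
      (∃ l : ℝ, Tendsto (fun lam => Q lam i j) atTop (𝓝 l)) ∨
        Tendsto (fun lam => Q lam i j) atTop atTop)
    (hjump : ∀ i j, i ≠ j →
      ∃ l : ℝ, Tendsto (fun lam => TwoTimeScale.jumpMatrix (Q lam) i j) atTop (𝓝 l))
    (hslow : (TwoTimeScale.slow Q).Nonempty)
    (hpos : ∀ i ∈ TwoTimeScale.slow Q,
      0 < TwoTimeScale.exitRate (TwoTimeScale.limitMatrix Q) i)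
    -- the limiting jump chain, started at any state, reaches the slow states almost surely
    {Ωη : Type*} [MeasurableSpace Ωη] (Pη : S → Measure Ωη) (η : ℕ → Ωη → S)
    (hη : ∀ i, TwoTimeScale.IsDiscreteMarkovChain (TwoTimeScale.limitJump Q) (Pi.single i 1)
      (Pη i) η)
    (hhit : ∀ i ∈ TwoTimeScale.fast Q,
      Pη i {ω | TwoTimeScale.hittingTime η (TwoTimeScale.slow Q) ω < ⊤} = 1)
    -- the reduced chain is irreducible
    (hred : TwoTimeScale.IsIrreducibleRate (TwoTimeScale.reducedRate Q))
    -- the initial distribution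
    (π : S → ℝ) (hπ : π ∈ stdSimplex ℝ S)
    -- the original chain, for each value of the parameter
    {ΩX : ℝ → Type*} [∀ lam, MeasurableSpace (ΩX lam)] (PX : ∀ lam, Measure (ΩX lam))
    (X : ∀ lam, ℝ≥0 → ΩX lam → S)
    (hX : ∀ lam, 0 < lam → TwoTimeScale.IsMarkovChain (Q lam) π (PX lam) (X lam))
    -- the reduced chain
    {ΩY : Type*} [MeasurableSpace ΩY] (PY : Measure ΩY)
    (Y : ℝ≥0 → ΩY → TwoTimeScale.slow Q)
    (hY : TwoTimeScale.IsMarkovChain (TwoTimeScale.reducedRate Q)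
      (TwoTimeScale.reducedInit Q π) PY Y)
    (h : ℝ≥0) (hh : 0 < h) :
    Tendsto (fun lam : ℝ => ⨆ (t : ℝ≥0) (_ : h ≤ t),
        ENNReal.ofReal (TwoTimeScale.tvDist
          (TwoTimeScale.law (PX lam) (X lam t))
          (TwoTimeScale.law PY (fun ω => (Y t ω : S)))))
      atTop (𝓝 0) := by
  open TwoTimeScale in
  open scoped Matrix.Norms.Operator in
  have hcover := mem_fast_or_mem_slow hrate hlim
  have : Nonempty (slow Q) := hslow.to_subtype
  have hW : ∀ i j, 0 ≤ block (limitJump Q) (fast Q) (fast Q) i j := fun i j =>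
    limitJump_nonneg hrate hjump i j
  have hWlim : ∀ i : fast Q, Tendsto
      (fun n => (block (limitJump Q) (fast Q) (fast Q) ^ n *ᵥ (1 : fast Q → ℝ)) i)
      atTop (𝓝 0) := fun i =>
    tendsto_pow_block_mulVec_one (disjoint_fast_slow Q) (hη i) (hhit i i.2)
  have hunit := isUnit_one_sub_of_tendsto hW hWlim
  have hpass : ∀ i j, 0 ≤ passage Q i j := fun i j =>
    inv_one_sub_mulVec_nonneg hW hWlim
      (y := fun a => block (limitJump Q) (fast Q) (slow Q) a j)
      (fun a => limitJump_nonneg hrate hjump a j) i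
  have hG := reducedRate_isRateMatrix hcover hrate hlim hjump hunit hpass
  obtain ⟨P, v, hP, hQJ, hv, hQv⟩ := exists_correctors hcover hrate hlim hjump hunit
  obtain ⟨C, hC, hCle⟩ := exists_eventually_mulVec_indicator_le hcover hrate hlim
  have hrate' : ∀ᶠ lam in atTop, IsRateMatrix (Q lam) :=
    (eventually_gt_atTop 0).mono hrate
  rw [ENNReal.tendsto_nhds_zero]
  intro ε hε
  -- The supremum is taken in `ℝ≥0∞`, so the tolerance may be `⊤` and is replaced by a real one.
  obtain ⟨δ, hδ, hδε⟩ : ∃ δ : ℝ, 0 < δ ∧ ENNReal.ofReal δ ≤ ε := by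
    rcases eq_or_ne ε ⊤ with rfl | hε'
    · exact ⟨1, one_pos, le_top⟩
    · exact ⟨ε.toReal, ENNReal.toReal_pos hε.ne' hε', ENNReal.ofReal_toReal hε' |>.le⟩
  filter_upwards [eventually_gt_atTop 0, eventually_norm_exp_sub_le
    (R := slowRestriction Q) hrate' hG hred (tendsto_extendRows hcover hP) hQJ
    (extendRows_passage_mulVec_one hcover hrate hjump hunit) hC
    (fun i => by split_ifs <;> norm_num) hCle hv hQv
    (fun lam => diagonal_mul_one_sub_extendRows_mul hcover (P lam))
    (NNReal.coe_pos.2 hh) hδ] with lam hlam hle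
  refine iSup₂_le fun t ht => (ENNReal.ofReal_le_ofReal ?_).trans hδε
  have hinit : reducedInit Q π = π ᵥ* extendRows Q (passage Q) := by
    ext b
    rw [vecMul_extendRows hcover, add_comm]
    rfl
  rw [(hX lam hlam).law_eq t, law_coe_slow, hY.law_eq t, hinit, Matrix.vecMul_vecMul,
    Matrix.vecMul_vecMul, ← Matrix.mul_assoc]
  exact (tvDist_vecMul_le hπ _ _).trans (hle t (NNReal.coe_le_coe.2 ht))
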